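/- Let $n\ge 0$ and let $\triangle\subset\mathbb R^n$ be the reflexive polytope of $X=\mathbb P^n$, i.e. the simplex with vertices $(-1,\dots,-1),(n,-1,\dots,-1),\dots,(-1,\dots,-1,n)$; its dual polytope $\triangle^\vee$ has vertices $u_0=(-1,\dots,-1)$, $u_k=e_k$ ($1\le k\le n$). Let $\mathcal A=\triangle\cap\mathbb Z^n=\{v_0=0,v_1,\dots,v_p\}$ and $L=\{\ell\in\mathbb Z^{p+1}:\sum_i\ell_iv_i=0,\ \sum_i\ell_i=0\}$. The *extended GKZ system* for a holomorphic function $f(a_0,\dots,a_p)$ consists of the equations $$\Big(\prod_{\ell_i>0}\partial_{a_i}^{\ell_i}-\prod_{\ell_i<0}\partial_{a_i}^{-\ell_i}\Big)f=0\ (\ell\in L),\qquad \sum_{i}v_i^j\,a_i\partial_{a_i}f=0\ (1\le j\le n),\qquad \Big(\sum_{i}a_i\partial_{a_i}+1\Big)f=0,$$ together with $$\pounds_v f=\sum_{v'\in\mathcal A,\ v'\notin F_u}(\langle v',u\rangle+1)\,a_{v'}\,\partial_{a_{v'+v}}f=0$$ for every vertex $u$ of $\triangle^\vee$ and every lattice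 point $v$ in the relative interior of the facet $F_u=\{x\in\triangle:\langle x,u\rangle=-1\}$. Let $\mathcal T$ be a regular projective triangulation of $\triangle$: every maximal simplex has $0$ as a vertex and its other vertices form a $\mathbb Z$-basis of $\mathbb Z^n$, and the set $\mathcal K_{\mathcal T}\subset\mathbb R^{p+1}$ of weights $\omega$ whose lower envelope induces $\mathcal T$ is non-empty. Let $M=\{\ell\in L:\langle\ell,\omega\rangle\ge0\ \forall\omega\in\mathcal K_{\mathcal T}\}$ be the set of integral points of the Mori cone, and let $$H=\mathbb C[D_0,\dots,D_p]/\mathcal I=\mathrm H^\bullet(\widetilde{X^\vee_{\mathcal T}},\mathbb C)$$ be the cohomology ring of the smooth projective toric variety of the fan of cones over the simplices of $\mathcal T$, where $\mathcal I$ is generated by $\sum_{i=0}^pD_i$, by $\sum_i v_i^jD_i$ ($1\le j\le n$), and by the products $D_{i_1}\cdots D_{i_k}$ over sets $\{i_1,\dots,i_k\}\subset\{1,\dots,p\}$ such that $v_{i_1},\dots,v_{i_k}$ do not generate a cone of this fan. Put $$B_{\mathbb P^n,\mathcal T}(a)=\frac1{a_0}\Big(\sum_{\ell\in M}O_\ell\,a^\ell\Big)\exp\Big(\sum_{i=0}^p(\log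 a_i)D_i\Big),$$ $$O_\ell=\frac{\prod_{i\ge1,\,\ell_i<0}D_i(D_i-1)\cdots(D_i+\ell_i+1)}{\prod_{i\ge1,\,\ell_i\ge0}(D_i+1)\cdots(D_i+\ell_i)}\,(D_0-1)(D_0-2)\cdots(D_0+\ell_0).$$ (1) Let $l^{(1)},\dots,l^{(r)}$ be any $\mathbb Z$-basis of $L$ such that every $\ell\in M$ is a combination of the $l^{(j)}$ with non-negative coefficients, and let $x_j=a^{l^{(j)}}$. Then there is $\varepsilon>0$ such that on $\{a\in(\mathbb C^*)^{p+1}:|x_j(a)|<\varepsilon\ \forall j\}$ the series $\sum_{\ell\in M}O_\ell a^\ell$ converges, and for every open subset $U$ of this set, every choice of holomorphic branches on $U$ of $\log a_0,\dots,\log a_p$, and every linear functional $\alpha$ on $H$, the coefficient function $a\mapsto\alpha\big(B_{\mathbb P^n,\mathcal T}(a)\cdot(-D_0)\big)$ is holomorphic on $U$ and solves the extended GKZ system there. (2) The operators $\pounds_v$ are the root vectors of $sl(n+1,\mathbb C)$: with $e_0=0$, the pairs $(u,v)$ above are exactly the pairs $(u_j,e_i-e_j)$ with $0\le i\ne j\le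 n$, and, if $a\in\mathbb C^{\mathcal A}$ is identified with the section $\sum_{v\in\mathcal A}a_v\prod_{k=0}^nz_k^{\langle v,u_k\rangle+1}$ of $-\omega_{\mathbb P^n}$, then $\pounds_{e_i-e_j}$ is the derivative along the linear vector field on $\mathbb C^{\mathcal A}$ given by the action $z_i\,\partial/\partial z_j$ of the elementary matrix $E_{ij}\in sl(n+1,\mathbb C)$ on sections. -/

import Mathlib

noncomputable section

namespace GKZ

/-! ### Reflexive polytopes and their lattice points -/

/-- The inclusion `ℤⁿ → ℝⁿ`. -/
def toReal {n : ℕ} (v : Fin n → ℤ) : Fin n → ℝ := fun k => (v k : ℝ)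

/-- The polar dual `{u | ⟨v, u⟩ ≥ -1 for all v ∈ S}`. -/
def polarDual {n : ℕ} (S : Set (Fin n → ℝ)) : Set (Fin n → ℝ) :=
  {u | ∀ v ∈ S, -1 ≤ v ⬝ᵥ u}

/-- A reflexive polytope in `ℝⁿ`: a lattice polytope with the origin in its interior, whose polar
dual has lattice points as vertices. -/
structure ReflexivePolytope (n : ℕ) where
  /-- a finite set of lattice points whose convex hull is the polytope -/
  verts : Finset (Fin n → ℤ)
  zero_mem_interior : (0 : Fin n → ℝ) ∈
    interior (convexHull ℝ (toReal '' (verts : Set (Fin n → ℤ))))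
  dual_lattice :
    ∀ u ∈ (polarDual (convexHull ℝ (toReal '' (verts : Set (Fin n → ℤ))))).extremePoints ℝ,
      ∃ w : Fin n → ℤ, toReal w = u

/-- The polytope `△` as a subset of `ℝⁿ`. -/
def ReflexivePolytope.carrier {n : ℕ} (P : ReflexivePolytope n) : Set (Fin n → ℝ) :=
  convexHull ℝ (toReal '' (P.verts : Set (Fin n → ℤ)))

/-- The set `𝒜 = △ ∩ ℤⁿ` of lattice points of `△`, as a type. It indexes the variables `a_v`. -/
abbrev ReflexivePolytope.Pt {n : ℕ} (P : ReflexivePolytope n) : Type :=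
  {v : Fin n → ℤ // toReal v ∈ P.carrier}

theorem ReflexivePolytope.finite_points {n : ℕ} (P : ReflexivePolytope n) :
    {v : Fin n → ℤ | toReal v ∈ P.carrier}.Finite := by
  have hb : Bornology.IsBounded P.carrier :=
    isBounded_convexHull.2 ((P.verts.finite_toSet.image toReal).isBounded)
  obtain ⟨R, hR⟩ := hb.exists_norm_le
  refine (Set.finite_Icc (fun _ : Fin n => -⌈R⌉) (fun _ => ⌈R⌉)).subset fun v hv => ?_
  have h : ∀ k, |(v k : ℝ)| ≤ ⌈R⌉ := fun k =>
    ((norm_le_pi_norm (toReal v) k).trans (hR _ hv)).trans (Int.le_ceil R)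
  refine ⟨fun k => ?_, fun k => ?_⟩
  · have := (abs_le.1 (h k)).1
    exact_mod_cast this
  · have := (abs_le.1 (h k)).2
    exact_mod_cast this

instance ReflexivePolytope.fintypePt {n : ℕ} (P : ReflexivePolytope n) : Fintype P.Pt :=
  P.finite_points.fintype

/-- The lattice point `v₀ = 0`. -/
def ReflexivePolytope.origin {n : ℕ} (P : ReflexivePolytope n) : P.Pt :=
  ⟨0, by
    have h : toReal (0 : Fin n → ℤ) = 0 := by ext; simp [toReal]
    rw [h]
    exact interior_subset P.zero_mem_interior⟩

/-! ### The extended GKZ system -/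

/-- The lattice `L` of affine linear relations among the lattice points of `△`. -/
def relationLattice {n : ℕ} (P : ReflexivePolytope n) : Submodule ℤ (P.Pt → ℤ) where
  carrier := {ℓ | (∀ j : Fin n, ∑ v, ℓ v * v.1 j = 0) ∧ ∑ v, ℓ v = 0}
  zero_mem' := by simp
  add_mem' := by
    rintro x y ⟨hx, hx'⟩ ⟨hy, hy'⟩
    exact ⟨fun j => by simp [add_mul, Finset.sum_add_distrib, hx, hy],
      by simp [Finset.sum_add_distrib, hx', hy']⟩
  smul_mem' := by
    rintro c x ⟨hx, hx'⟩
    exact ⟨fun j => by simp [mul_assoc, ← Finset.mul_sum, hx],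
      by simp [← Finset.mul_sum, hx']⟩

/-- The partial derivative `∂f/∂a_v`. -/
def partialDeriv {n : ℕ} {P : ReflexivePolytope n} (v : P.Pt) (f : (P.Pt → ℂ) → ℂ) :
    (P.Pt → ℂ) → ℂ :=
  fun a => fderiv ℂ f a (Pi.single v 1)

/-- The iterated partial derivative `∏_v (∂/∂a_v)^{k_v} f`. -/
def mixedDeriv {n : ℕ} {P : ReflexivePolytope n} (k : P.Pt → ℕ) (f : (P.Pt → ℂ) → ℂ) :
    (P.Pt → ℂ) → ℂ :=
  (Finset.univ : Finset P.Pt).toList.foldr (fun v g => (partialDeriv v)^[k v] g) f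

/-- Holomorphic solutions on `U` of the GKZ system of `△`. -/
structure IsGKZSolution {n : ℕ} (P : ReflexivePolytope n) (U : Set (P.Pt → ℂ))
    (f : (P.Pt → ℂ) → ℂ) : Prop where
  holomorphic : DifferentiableOn ℂ f U
  box : ∀ ℓ ∈ relationLattice P, ∀ a ∈ U,
    mixedDeriv (fun v => (ℓ v).toNat) f a - mixedDeriv (fun v => (-ℓ v).toNat) f a = 0
  torus : ∀ j : Fin n, ∀ a ∈ U, ∑ v : P.Pt, (v.1 j : ℂ) * a v * partialDeriv v f a = 0
  euler : ∀ a ∈ U, ∑ v : P.Pt, a v * partialDeriv v f a + f a = 0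

/-- `u` is a vertex of the dual polytope of `△`, and `v` is a lattice point in the relative
interior of the corresponding facet `F_u = {x ∈ △ | ⟨x, u⟩ = -1}` of `△`. -/
def IsRoot {n : ℕ} (P : ReflexivePolytope n) (u v : Fin n → ℤ) : Prop :=
  toReal u ∈ (polarDual P.carrier).extremePoints ℝ ∧
    toReal v ∈ intrinsicInterior ℝ {x | x ∈ P.carrier ∧ x ⬝ᵥ toReal u = -1}

/-- The operator `£_v = ∑_{v' ∉ F_u} (⟨v', u⟩ + 1) a_{v'} ∂/∂a_{v' + v}`, for `v` in the relative
interior of the facet `F_u`. -/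
def rootOperator {n : ℕ} (P : ReflexivePolytope n) (u v : Fin n → ℤ) (f : (P.Pt → ℂ) → ℂ)
    (a : P.Pt → ℂ) : ℂ :=
  ∑ v' : P.Pt, ∑ w : P.Pt with v'.1 ⬝ᵥ u ≠ -1 ∧ w.1 = v'.1 + v,
    ((v'.1 ⬝ᵥ u + 1 : ℤ) : ℂ) * a v' * partialDeriv w f a

/-- Holomorphic solutions on `U` of the extended GKZ system of `△`. -/
structure IsExtendedGKZSolution {n : ℕ} (P : ReflexivePolytope n) (U : Set (P.Pt → ℂ))
    (f : (P.Pt → ℂ) → ℂ) : Prop extends IsGKZSolution P U f where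
  root : ∀ u v, IsRoot P u v → ∀ a ∈ U, rootOperator P u v f a = 0

/-! ### Regular projective triangulations, Kähler cone and Mori cone -/

/-- The weights `ω ∈ ℝ^𝒜` for which the lower envelope of the points `(v, ω_v)` induces the
triangulation `T`: on each maximal simplex the weights are interpolated by an affine function which
lies strictly below the weights at all other lattice points. This is the preimage in `ℝ^𝒜` of the
(open) Kähler cone in `ℝ^𝒜 / ℝ^{n+1} = H²(X̃ᵛ, ℝ)`. -/
def kaehlerCone {n : ℕ} (P : ReflexivePolytope n) (T : Geometry.SimplicialComplex ℝ (Fin n → ℝ)) :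
    Set (P.Pt → ℝ) :=
  {ω | ∀ s ∈ T.facets, ∃ (c : ℝ) (m : Fin n → ℝ), ∀ v : P.Pt,
    c + m ⬝ᵥ toReal v.1 ≤ ω v ∧ (c + m ⬝ᵥ toReal v.1 = ω v ↔ toReal v.1 ∈ s)}

/-- `T` is a regular projective triangulation of `△`: it triangulates `△`; each of its maximal
simplices has the origin as a vertex, and its other vertices form a `ℤ`-basis of `ℤⁿ` (so that it
has normalized volume one); and `T` is induced by a weight. -/
structure IsRegularProjective {n : ℕ} (P : ReflexivePolytope n)
    (T : Geometry.SimplicialComplex ℝ (Fin n → ℝ)) : Prop where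
  space_eq : T.space = P.carrier
  regular : ∀ s ∈ T.facets, ∃ b : Module.Basis (Fin n) ℤ (Fin n → ℤ),
    (s : Set (Fin n → ℝ)) = insert 0 (Set.range fun k => toReal (b k))
  projective : (kaehlerCone P T).Nonempty

/-- The set `M` of integral points of the Mori cone, the dual cone of the Kähler cone. -/
def moriPoints {n : ℕ} (P : ReflexivePolytope n) (T : Geometry.SimplicialComplex ℝ (Fin n → ℝ)) :
    Set (P.Pt → ℤ) :=
  {ℓ | ℓ ∈ relationLattice P ∧ ∀ ω ∈ kaehlerCone P T, 0 ≤ ∑ v, (ℓ v : ℝ) * ω v}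

/-! ### The cohomology ring -/

open Classical in
/-- The ideal generated by `∑_v D_v`, by `∑_v v_j D_v` for `1 ≤ j ≤ n`, and by the products
`D_{v_1} ⋯ D_{v_k}` over nonzero lattice points `v_1, …, v_k` of `△` which do not span a cone over a
simplex of `T`. -/
def cohomologyIdeal {n : ℕ} (P : ReflexivePolytope n)
    (T : Geometry.SimplicialComplex ℝ (Fin n → ℝ)) : Ideal (MvPolynomial P.Pt ℂ) :=
  Ideal.span
    ({∑ v : P.Pt, MvPolynomial.X v} ∪
      Set.range (fun j : Fin n => ∑ v : P.Pt, MvPolynomial.C (v.1 j : ℂ) * MvPolynomial.X v) ∪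
      {q | ∃ S : Finset P.Pt, S.Nonempty ∧ P.origin ∉ S ∧
        S.image (fun v => toReal v.1) ∉ T.faces ∧ q = ∏ v ∈ S, MvPolynomial.X v})

/-- The cohomology ring `H^•(X̃ᵛ_T, ℂ)` of the smooth projective toric variety whose fan consists of
the cones over the simplices of `T`. -/
def Cohomology {n : ℕ} (P : ReflexivePolytope n)
    (T : Geometry.SimplicialComplex ℝ (Fin n → ℝ)) : Type :=
  MvPolynomial P.Pt ℂ ⧸ cohomologyIdeal P T

instance {n : ℕ} (P : ReflexivePolytope n) (T : Geometry.SimplicialComplex ℝ (Fin n → ℝ)) :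
    CommRing (Cohomology P T) :=
  inferInstanceAs (CommRing (MvPolynomial P.Pt ℂ ⧸ cohomologyIdeal P T))

instance {n : ℕ} (P : ReflexivePolytope n) (T : Geometry.SimplicialComplex ℝ (Fin n → ℝ)) :
    Algebra ℂ (Cohomology P T) :=
  inferInstanceAs (Algebra ℂ (MvPolynomial P.Pt ℂ ⧸ cohomologyIdeal P T))

instance {n : ℕ} (P : ReflexivePolytope n) (T : Geometry.SimplicialComplex ℝ (Fin n → ℝ)) :
    Algebra ℚ (Cohomology P T) :=
  inferInstanceAs (Algebra ℚ (MvPolynomial P.Pt ℂ ⧸ cohomologyIdeal P T))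

/-- The canonical topology of the (finite-dimensional) complex vector space `H^•(X̃ᵛ_T, ℂ)`. -/
instance {n : ℕ} (P : ReflexivePolytope n) (T : Geometry.SimplicialComplex ℝ (Fin n → ℝ)) :
    TopologicalSpace (Cohomology P T) :=
  moduleTopology ℂ (Cohomology P T)

/-- The divisor class `D_v`. For `v = 0` it is the artificial, i.e. canonical, class `D₀`. -/
def divisorClass {n : ℕ} (P : ReflexivePolytope n)
    (T : Geometry.SimplicialComplex ℝ (Fin n → ℝ)) (v : P.Pt) : Cohomology P T :=
  Ideal.Quotient.mk (cohomologyIdeal P T) (MvPolynomial.X v)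

/-! ### The function `B` -/

/-- The class `O_ℓ`, for `ℓ₀ ≤ 0`. All classes `D_v` are nilpotent, so that the denominator is
invertible. -/
def oCoeff {n : ℕ} (P : ReflexivePolytope n) (T : Geometry.SimplicialComplex ℝ (Fin n → ℝ))
    (ℓ : P.Pt → ℤ) : Cohomology P T :=
  (∏ v : P.Pt with v ≠ P.origin ∧ ℓ v < 0,
      ∏ k ∈ Finset.range (-ℓ v).toNat, (divisorClass P T v - (k : Cohomology P T))) *
    Ring.inverse (∏ v : P.Pt with v ≠ P.origin ∧ 0 ≤ ℓ v,
      ∏ k ∈ Finset.range (ℓ v).toNat, (divisorClass P T v + ((k + 1 : ℕ) : Cohomology P T))) *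
    ∏ k ∈ Finset.range (-ℓ P.origin).toNat,
      (divisorClass P T P.origin - ((k + 1 : ℕ) : Cohomology P T))

/-- The Laurent monomial `a^ℓ`. -/
def laurent {n : ℕ} {P : ReflexivePolytope n} (ℓ : P.Pt → ℤ) (a : P.Pt → ℂ) : ℂ :=
  ∏ v, a v ^ ℓ v

/-- The function `B(a) = a₀⁻¹ (∑_{ℓ ∈ M} O_ℓ a^ℓ) exp (∑_v (log a_v) D_v)` with values in
`H^•(X̃ᵛ_T, ℂ)`, where `log a_v` stands for the given branch `lg a v` of the logarithm. -/
def bFunction {n : ℕ} (P : ReflexivePolytope n) (T : Geometry.SimplicialComplex ℝ (Fin n → ℝ))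
    (lg : (P.Pt → ℂ) → P.Pt → ℂ) (a : P.Pt → ℂ) : Cohomology P T :=
  (a P.origin)⁻¹ • ((∑' ℓ : moriPoints P T, laurent ℓ.1 a • oCoeff P T ℓ.1) *
    IsNilpotent.exp (∑ v, lg a v • divisorClass P T v))

/-- The points `a` with all coordinates nonzero and `|x_j(a)| < ε` for the monomials
`x_j = a^{l^{(j)}}`, where `l^{(1)}, …, l^{(r)}` is a given basis of the relation lattice. -/
def lcslNhd {n r : ℕ} (P : ReflexivePolytope n) (l : Module.Basis (Fin r) ℤ (relationLattice P))
    (ε : ℝ) : Set (P.Pt → ℂ) :=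
  {a | (∀ v, a v ≠ 0) ∧ ∀ j, ‖laurent (l j).1 a‖ < ε}

/-- `lg` is a holomorphic choice on `U` of logarithms of all the coordinates. -/
structure IsLogBranch {n : ℕ} {P : ReflexivePolytope n} (U : Set (P.Pt → ℂ))
    (lg : (P.Pt → ℂ) → P.Pt → ℂ) : Prop where
  holomorphic : DifferentiableOn ℂ lg U
  exp_eq : ∀ a ∈ U, ∀ v, Complex.exp (lg a v) = a v

/-! ### Projective space -/

/-- The points `u_0 = (-1, …, -1)` and `u_k = e_k`, `1 ≤ k ≤ n`, of `ℤⁿ`. -/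
def simplexNormal {n : ℕ} : Fin (n + 1) → Fin n → ℤ :=
  Fin.cons (fun _ => -1) (fun k => Pi.single k 1)

/-- The points `0, e_1, …, e_n` of `ℤⁿ`. -/
def simplexPoint {n : ℕ} : Fin (n + 1) → Fin n → ℤ :=
  Fin.cons 0 (fun k => Pi.single k 1)

/-- The points `(-1, …, -1)`, `(n, -1, …, -1)`, …, `(-1, …, -1, n)` of `ℤⁿ`. -/
def simplexVertex {n : ℕ} (i : Fin (n + 1)) : Fin n → ℤ :=
  fun k => (n + 1) * simplexPoint i k - 1

theorem simplexVertex_dot {n : ℕ} (i : Fin (n + 1)) (u : Fin n → ℝ) :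
    toReal (simplexVertex i) ⬝ᵥ u = (n + 1) * (toReal (simplexPoint i) ⬝ᵥ u) - ∑ k, u k := by
  simp only [dotProduct, toReal, simplexVertex, Finset.mul_sum, ← Finset.sum_sub_distrib]
  refine Finset.sum_congr rfl fun k _ => ?_
  push_cast
  ring

theorem mem_simplex {n : ℕ} (x : Fin n → ℝ) (hx : ∀ k, -1 ≤ x k) (hs : ∑ k, x k ≤ 1) :
    x ∈ convexHull ℝ (toReal ''
      ((Finset.univ.image simplexVertex : Finset (Fin n → ℤ)) : Set (Fin n → ℤ))) := by
  have hn : (0 : ℝ) < n + 1 := by positivity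
  refine mem_convexHull_of_exists_fintype
    (Fin.cons ((1 - ∑ k, x k) / (n + 1)) (fun k => (x k + 1) / (n + 1)) : Fin (n + 1) → ℝ)
    (fun i => toReal (simplexVertex i)) ?_ ?_ ?_ ?_
  · intro i
    refine Fin.cases ?_ (fun k => ?_) i
    · exact div_nonneg (by linarith) hn.le
    · exact div_nonneg (by linarith [hx k]) hn.le
  · rw [Fin.sum_univ_succ]
    simp only [Fin.cons_zero, Fin.cons_succ, ← Finset.sum_div, Finset.sum_add_distrib]
    simp only [Finset.sum_const, Finset.card_univ, Fintype.card_fin, nsmul_eq_mul, mul_one]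
    field_simp
    ring
  · intro i
    exact ⟨_, by simp, rfl⟩
  · ext j
    rw [Fin.sum_univ_succ]
    simp only [Fin.cons_zero, Fin.cons_succ, Pi.add_apply, Pi.smul_apply, Finset.sum_apply,
      smul_eq_mul, toReal, simplexVertex, simplexPoint, Pi.zero_apply, Pi.single_apply]
    push_cast
    simp only [mul_sub, mul_ite, mul_one, mul_zero, Finset.sum_sub_distrib, Finset.sum_ite_eq,
      Finset.mem_univ, if_true, ← Finset.sum_div, Finset.sum_add_distrib, Finset.sum_const,
      Finset.card_univ, Fintype.card_fin, nsmul_eq_mul]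
    field_simp
    ring

theorem mem_dualSimplex {n : ℕ} (u : Fin n → ℝ)
    (hu : ∀ i : Fin (n + 1), -1 ≤ toReal (simplexVertex i) ⬝ᵥ u) :
    u ∈ convexHull ℝ (Set.range fun i : Fin (n + 1) => toReal (simplexNormal i : Fin n → ℤ)) := by
  have hn : (0 : ℝ) < n + 1 := by positivity
  have h0 : ∑ k, u k ≤ 1 := by
    have := hu 0
    rw [simplexVertex_dot] at this
    simp [simplexPoint, toReal, dotProduct] at this
    linarith
  have hk : ∀ k, 0 ≤ u k + (1 - ∑ k, u k) / (n + 1) := fun k => by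
    have := hu k.succ
    rw [simplexVertex_dot] at this
    simp [simplexPoint, toReal, dotProduct, Pi.single_apply] at this
    have h2 : u k + (1 - ∑ k, u k) / (n + 1) = ((n + 1) * u k + (1 - ∑ k, u k)) / (n + 1) := by
      field_simp
    rw [h2]
    exact div_nonneg (by linarith) hn.le
  refine mem_convexHull_of_exists_fintype
    (Fin.cons ((1 - ∑ k, u k) / (n + 1)) (fun k => u k + (1 - ∑ k, u k) / (n + 1)) :
      Fin (n + 1) → ℝ)
    (fun i => toReal (simplexNormal i)) ?_ ?_ ?_ ?_
  · intro i
    refine Fin.cases ?_ (fun k => ?_) i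
    · exact div_nonneg (by linarith) hn.le
    · exact hk k
  · rw [Fin.sum_univ_succ]
    simp only [Fin.cons_zero, Fin.cons_succ, Finset.sum_add_distrib]
    simp only [Finset.sum_const, Finset.card_univ, Fintype.card_fin, nsmul_eq_mul]
    field_simp
    ring
  · exact fun i => ⟨i, rfl⟩
  · ext j
    rw [Fin.sum_univ_succ]
    simp only [Fin.cons_zero, Fin.cons_succ, Pi.add_apply, Pi.smul_apply, Finset.sum_apply,
      smul_eq_mul, toReal, simplexNormal, Pi.single_apply]
    push_cast
    simp only [mul_ite, mul_one, mul_zero, Finset.sum_ite_eq, Finset.mem_univ, if_true]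
    ring

theorem neg_one_le_simplexVertex_dot {n : ℕ} (j i : Fin (n + 1)) :
    -1 ≤ toReal (simplexVertex j : Fin n → ℤ) ⬝ᵥ toReal (simplexNormal i) := by
  have hn : (0 : ℝ) ≤ n := by positivity
  rw [simplexVertex_dot]
  refine Fin.cases ?_ (fun k => ?_) i <;> refine Fin.cases ?_ (fun l => ?_) j <;>
    simp [simplexPoint, simplexNormal, toReal, dotProduct, Pi.single_apply]
  · linarith
  · split_ifs <;> linarith

/-- The reflexive polytope of the anticanonically polarized projective space `ℙⁿ`. Its dual
polytope has the vertices `simplexNormal i`, so that its normal fan is the fan of `ℙⁿ`. -/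
def projectivePolytope (n : ℕ) : ReflexivePolytope n where
  verts := Finset.univ.image simplexVertex
  zero_mem_interior := by
    refine mem_interior.2 ⟨{x | (∀ k, -1 < x k) ∧ ∑ k, x k < 1}, ?_, ?_, by simp⟩
    · exact fun x hx => mem_simplex x (fun k => (hx.1 k).le) hx.2.le
    · simp only [Set.ofPred_and, Set.ofPred_forall]
      exact (isOpen_iInter_of_finite fun k => isOpen_lt continuous_const (continuous_apply k)).inter
        (isOpen_lt (by fun_prop) continuous_const)
  dual_lattice := by
    intro u hu
    have hsub : polarDual (convexHull ℝ (toReal ''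
        ((Finset.univ.image simplexVertex : Finset (Fin n → ℤ)) : Set (Fin n → ℤ)))) =
        convexHull ℝ (Set.range fun i : Fin (n + 1) => toReal (simplexNormal i : Fin n → ℤ)) := by
      refine Set.Subset.antisymm (fun w hw => mem_dualSimplex w fun i =>
        hw _ (subset_convexHull ℝ _ ⟨_, by simp, rfl⟩)) ?_
      refine convexHull_min ?_ ?_
      · rintro _ ⟨i, rfl⟩ v hv
        refine convexHull_min (t := {x | -1 ≤ x ⬝ᵥ toReal (simplexNormal i)}) ?_ ?_ hv
        · rintro _ ⟨w, hw, rfl⟩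
          obtain ⟨j, -, rfl⟩ := Finset.mem_image.1 (Finset.mem_coe.1 hw)
          exact neg_one_le_simplexVertex_dot j i
        · exact convex_halfSpace_ge ⟨fun x y => add_dotProduct x y _,
            fun c x => smul_dotProduct c x _⟩ _
      · intro x hx y hy s t hs ht hst v hv
        have h1 := hx v hv
        have h2 := hy v hv
        rw [dotProduct_add, dotProduct_smul, dotProduct_smul, smul_eq_mul, smul_eq_mul]
        nlinarith
    rw [hsub] at hu
    obtain ⟨i, hi⟩ := extremePoints_convexHull_subset hu
    exact ⟨_, hi⟩

/-- The section `∑_v a_v ∏_i z_i^{⟨v, u_i⟩ + 1}` of the anticanonical bundle of `ℙⁿ` with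
coefficients `a`, as a homogeneous polynomial of degree `n + 1` in `z_0, …, z_n`. -/
def anticanonicalSection {n : ℕ} (a : (projectivePolytope n).Pt → ℂ) :
    MvPolynomial (Fin (n + 1)) ℂ :=
  ∑ v : (projectivePolytope n).Pt,
    MvPolynomial.C (a v) * ∏ i, MvPolynomial.X i ^ (v.1 ⬝ᵥ simplexNormal i + 1).toNat

/-- The infinitesimal action of `A ∈ sl(n+1, ℂ)` on `ℂ[z_0, …, z_n]` by linear vector fields, where
the elementary matrix `E_{ij}` acts by `z_i ∂/∂z_j`. -/
def slAction {n : ℕ} (A : LieAlgebra.SpecialLinear.sl (Fin (n + 1)) ℂ)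
    (q : MvPolynomial (Fin (n + 1)) ℂ) : MvPolynomial (Fin (n + 1)) ℂ :=
  ∑ i, ∑ j, A.1 i j • (MvPolynomial.X i * MvPolynomial.pderiv j q)

end GKZ

end

/-! Write `e_v` for the unit exponents, `e_0` for the one at the origin, and put `Φ_γ(a) = ∑_{m ∈
γ+L} ∏_v Γ(D_v+1)/Γ(D_v+m_v+1) · a^{m+D}` (`hyperSeries`). The functional equation of `Γ` gives
`∂Φ_γ/∂a_v = Φ_{γ-e_v}` (`hasFDerivAt_hyperSeries`), and reindexing the sum shows that `Φ_γ` depends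
only on `γ` modulo `L` (`hyperSeries_eq_of_sub_mem`). All box equations follow at once. The first
order equations all come from `∑_v β_v a_v Φ_{δ-e_v} = κ Φ_δ` (`sum_smul_hyperSeries`), valid when
`β` kills `L` and the classes `D`, and `∑ β_v δ_v = κ`. For the torus and Euler operators `δ =
-e_0`. For `£_v` take `β_{v'} = ⟨v',u⟩+1` and `δ = -e_v`: since `e_0 + e_{v+v'} ≡ e_v + e_{v'}`
modulo `L`, the operator applied to `Φ_{-e_0}` becomes this sum, with `κ = -(⟨v,u⟩+1) = 0`.

It remains to see that `B · D_0 = Φ_{-e_0}`. Multiplying `O_ℓ` by `D_0` supplies the missing factor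
at the origin (`oCoeff_mul_divisorClass_origin`), provided `ℓ_0 ≤ 0` whenever the coefficient can be
nonzero. A nonzero coefficient has its negative entries on a simplex of the triangulation, by the
Stanley-Reisner relations. This puts `ℓ` in `M`, and it gives `ℓ_0 ≤ 0` because the nonzero vertices
of a maximal simplex lie on one facet of the polytope (`exists_facet_normal`,
`apply_origin_nonpos`).

Convergence: the `D_v` are nilpotent, so the cohomology ring is a finite-dimensional algebra and
carries a Banach algebra norm. The entries of an exponent in `γ+L` have a fixed sum, so the
factorials balance and coefficients grow at most exponentially. Their support lies in a translated
orthant in the coordinates of the basis, and the series is dominated by a product of geometric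
series (`exists_summable_bound`). The statements on roots and on `sl(n+1)` are computations with the
pairings `⟨v, u_k⟩`. -/

noncomputable section

namespace GKZ

/-! ### Coefficients of the hypergeometric series -/

section Coefficients

variable {R : Type*} [CommRing R]

/-- The quotient `Γ(D + 1) / Γ(D + m + 1)`, for nilpotent `D`. -/
def gammaQuot (D : R) (m : ℤ) : R :=
  (∏ k ∈ Finset.range (-m).toNat, (D - (k : R))) *
    Ring.inverse (∏ k ∈ Finset.range m.toNat, (D + ((k + 1 : ℕ) : R)))

theorem gammaQuot_of_neg {D : R} {m : ℤ} (hm : m < 0) :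
    gammaQuot D m = ∏ k ∈ Finset.range (-m).toNat, (D - (k : R)) := by
  simp [gammaQuot, Int.toNat_of_nonpos hm.le]

theorem gammaQuot_of_nonneg {D : R} {m : ℤ} (hm : 0 ≤ m) :
    gammaQuot D m = Ring.inverse (∏ k ∈ Finset.range m.toNat, (D + ((k + 1 : ℕ) : R))) := by
  simp [gammaQuot, Int.toNat_of_nonpos (neg_nonpos.2 hm)]

/-- The factor with `k = 0` is `D` itself. Every vanishing statement for coefficients rests on this.
-/
theorem dvd_gammaQuot {D : R} {m : ℤ} (hm : m < 0) : D ∣ gammaQuot D m := by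
  rw [gammaQuot_of_neg hm]
  obtain ⟨k, hk⟩ : ∃ k, (-m).toNat = k + 1 := ⟨(-m).toNat - 1, by omega⟩
  rw [hk, Finset.prod_range_succ']
  simp

theorem isUnit_add_natCast_succ [Algebra ℂ R] {D : R} (hD : IsNilpotent D) (k : ℕ) :
    IsUnit (D + ((k + 1 : ℕ) : R)) := by
  have h : IsUnit ((k + 1 : ℕ) : R) := by
    have h1 : IsUnit ((k + 1 : ℕ) : ℂ) := IsUnit.mk0 _ (Nat.cast_ne_zero.2 k.succ_ne_zero)
    simpa using h1.map (algebraMap ℂ R)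
  rw [add_comm]
  exact hD.isUnit_add_left_of_commute h (Commute.all _ _)

/-- This is `Γ(z+1) = zΓ(z)` at `z = D + m`. Nilpotency is needed for `m > 0`, where `D + m` has to
be cancelled against its inverse. -/
theorem gammaQuot_sub_one [Algebra ℂ R] {D : R} (hD : IsNilpotent D) (m : ℤ) :
    gammaQuot D (m - 1) = (D + (m : R)) * gammaQuot D m := by
  rcases lt_trichotomy m 0 with hm | rfl | hm
  · rw [gammaQuot_of_neg hm, gammaQuot_of_neg (by omega)]
    obtain ⟨k, rfl⟩ : ∃ k : ℕ, m = -k := ⟨m.natAbs, by omega⟩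
    rw [show (-(-(k : ℤ) - 1)).toNat = k + 1 by omega, show (-(-(k : ℤ))).toNat = k by omega,
      Finset.prod_range_succ]
    push_cast
    ring
  · rw [gammaQuot_of_nonneg le_rfl, gammaQuot_of_neg (by omega)]
    simp
  · rw [gammaQuot_of_nonneg hm.le, gammaQuot_of_nonneg (by omega)]
    obtain ⟨k, rfl⟩ : ∃ k : ℕ, m = k + 1 := ⟨m.natAbs - 1, by omega⟩
    rw [show ((k : ℤ) + 1 - 1).toNat = k by omega, show ((k : ℤ) + 1).toNat = k + 1 by omega,
      Finset.prod_range_succ, Ring.mul_inverse_rev, ← mul_assoc]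
    have := Ring.mul_inverse_cancel _ (isUnit_add_natCast_succ hD k)
    push_cast at this ⊢
    rw [this, one_mul]

variable {ι : Type*} [Fintype ι]

/-- The coefficient `∏_v Γ(D_v + 1) / Γ(D_v + m_v + 1)` of the monomial `a^m`. -/
def gammaCoeff (D : ι → R) (m : ι → ℤ) : R :=
  ∏ v, gammaQuot (D v) (m v)

theorem gammaCoeff_sub_single [DecidableEq ι] [Algebra ℂ R] {D : ι → R}
    (hD : ∀ v, IsNilpotent (D v)) (m : ι → ℤ) (v : ι) :
    gammaCoeff D (m - Pi.single v 1) = (D v + (m v : R)) * gammaCoeff D m := by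
  unfold gammaCoeff
  rw [← Finset.mul_prod_erase _ _ (Finset.mem_univ v),
    ← Finset.mul_prod_erase _ (fun v => gammaQuot (D v) (m v)) (Finset.mem_univ v), ← mul_assoc,
    Pi.sub_apply, Pi.single_eq_same, gammaQuot_sub_one (hD v)]
  congr 1
  refine Finset.prod_congr rfl fun w hw => ?_
  rw [Pi.sub_apply, Pi.single_eq_of_ne (Finset.ne_of_mem_erase hw), sub_zero]

theorem prod_dvd_gammaCoeff (D : ι → R) {m : ι → ℤ} {S : Finset ι} (hS : ∀ v ∈ S, m v < 0) :
    ∏ v ∈ S, D v ∣ gammaCoeff D m :=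
  (Finset.prod_dvd_prod_of_dvd _ _ fun v hv => dvd_gammaQuot (hS v hv)).trans
    (Finset.prod_dvd_prod_of_subset _ _ _ (Finset.subset_univ S))

theorem inverse_prod {κ : Type*} (s : Finset κ) (f : κ → R) :
    Ring.inverse (∏ i ∈ s, f i) = ∏ i ∈ s, Ring.inverse (f i) := by
  classical
  induction s using Finset.induction_on with
  | empty => simp
  | insert i s hi ih => rw [Finset.prod_insert hi, Finset.prod_insert hi, Ring.mul_inverse_rev, ih,
      mul_comm]

end Coefficients

/-! ### Estimates -/

section Estimates

theorem add_factorial_le (a b : ℕ) :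
    (a + b).factorial ≤ 2 ^ (a + b) * (a.factorial * b.factorial) := by
  rw [← Nat.add_choose_mul_factorial_mul_factorial a b, mul_assoc]
  exact Nat.mul_le_mul_right _ (Nat.choose_le_two_pow _ _)

/-- A crude bound for the multinomial coefficient, splitting off one index at a time at the cost of
one binomial coefficient. -/
theorem factorial_sum_le {κ : Type*} (s : Finset κ) (k : κ → ℕ) :
    (∑ i ∈ s, k i).factorial ≤ (2 ^ s.card) ^ (∑ i ∈ s, k i) * ∏ i ∈ s, (k i).factorial := by
  classical
  induction s using Finset.induction_on with
  | empty => simp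
  | insert i s hi ih =>
    rw [Finset.sum_insert hi, Finset.prod_insert hi, Finset.card_insert_of_notMem hi]
    calc _ ≤ 2 ^ (k i + ∑ i ∈ s, k i) * ((k i).factorial * (∑ i ∈ s, k i).factorial) :=
          add_factorial_le _ _
      _ ≤ 2 ^ (k i + ∑ i ∈ s, k i) * ((k i).factorial *
          ((2 ^ s.card) ^ (k i + ∑ i ∈ s, k i) * ∏ i ∈ s, (k i).factorial)) := by
          gcongr
          refine ih.trans ?_
          gcongr
          · exact Nat.one_le_two_pow
          · omega
      _ = _ := by
          rw [pow_succ, mul_pow]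
          ring

/-- The size `1 / m!`, respectively `|m|!`, of the `m`-th coefficient. -/
def gammaWeight (m : ℤ) : ℝ :=
  ((-m).toNat.factorial : ℝ) / (m.toNat.factorial : ℝ)

theorem gammaWeight_nonneg (m : ℤ) : 0 ≤ gammaWeight m := by
  unfold gammaWeight; positivity

theorem toNat_add_toNat_neg (m : ℤ) : m.toNat + (-m).toNat = m.natAbs := by omega

/-- Let `p` and `q` be the sums of the positive and negative parts, so `p - q = s`. The numerator is
at most `q!`, which is comparable to `p!` as `q ≤ p + |s|`, and `p!` exceeds the denominator only by
a multinomial coefficient. Fixing the sum is what keeps the growth exponential. -/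
theorem prod_gammaWeight_le {ι : Type*} [Fintype ι] (s : ℤ) :
    ∃ C : ℝ, 0 ≤ C ∧ ∀ m : ι → ℤ, ∑ v, m v = s →
      ∏ v, gammaWeight (m v) ≤ C * (2 * 2 ^ Fintype.card ι) ^ ∑ v, (m v).natAbs := by
  refine ⟨2 ^ s.natAbs * s.natAbs.factorial, by positivity, fun m hm => ?_⟩
  set p := ∑ v, (m v).toNat with hp
  set q := ∑ v, (-m v).toNat with hq
  have hpq : (p : ℤ) - q = s := by
    rw [hp, hq, ← hm]
    push_cast
    rw [← Finset.sum_sub_distrib]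
    exact Finset.sum_congr rfl fun v _ => Int.toNat_sub_toNat_neg _
  have hN : ∑ v, (m v).natAbs = p + q := by
    rw [hp, hq, ← Finset.sum_add_distrib]
    exact Finset.sum_congr rfl fun v _ => (toNat_add_toNat_neg _).symm
  have h1 : (∏ v, (-m v).toNat.factorial) ≤ q.factorial :=
    Nat.le_of_dvd (Nat.factorial_pos _) (Nat.prod_factorial_dvd_factorial_sum _ _)
  have h2 : p.factorial ≤ (2 ^ Fintype.card ι) ^ p * ∏ v, (m v).toNat.factorial :=
    factorial_sum_le Finset.univ fun v => (m v).toNat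
  have h3 : q.factorial ≤ 2 ^ (p + s.natAbs) * (p.factorial * s.natAbs.factorial) :=
    (Nat.factorial_le (by omega)).trans (add_factorial_le _ _)
  unfold gammaWeight
  rw [Finset.prod_div_distrib, div_le_iff₀ (by positivity), hN]
  have h4 : (∏ v, (-m v).toNat.factorial) ≤
      2 ^ s.natAbs * s.natAbs.factorial * (2 * 2 ^ Fintype.card ι) ^ (p + q) *
        ∏ v, (m v).toNat.factorial := by
    calc _ ≤ 2 ^ (p + s.natAbs) * (p.factorial * s.natAbs.factorial) := h1.trans h3
      _ ≤ 2 ^ (p + s.natAbs) * (((2 ^ Fintype.card ι) ^ p * ∏ v, (m v).toNat.factorial) *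
          s.natAbs.factorial) := by gcongr
      _ = 2 ^ s.natAbs * s.natAbs.factorial * (2 * 2 ^ Fintype.card ι) ^ p *
        ∏ v, (m v).toNat.factorial := by rw [mul_pow]; ring
      _ ≤ _ := by
        gcongr
        · exact Nat.one_le_iff_ne_zero.2 (by positivity)
        · omega
  exact_mod_cast h4

variable {R : Type*} [NormedCommRing R]

/-- The norm is not assumed to satisfy `‖1‖ = 1`, and the empty product makes the extra factor
necessary. -/
theorem norm_prod_le_norm_one_mul {κ : Type*} (s : Finset κ) (f : κ → R) :
    ‖∏ i ∈ s, f i‖ ≤ ‖(1 : R)‖ * ∏ i ∈ s, ‖f i‖ := by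
  classical
  induction s using Finset.induction_on with
  | empty => simp
  | insert i s hi ih =>
    rw [Finset.prod_insert hi, Finset.prod_insert hi, mul_left_comm]
    exact (norm_mul_le _ _).trans (by gcongr)

/-- The offset `i = 0` serves `gammaQuot`, while `i = 1` serves the factor of `O_ℓ` at the origin,
which starts at `D_0 - 1`. -/
theorem norm_prod_range_le (D : R) (i n : ℕ) (hi : i ≤ 1) :
    ‖∏ k ∈ Finset.range n, (D - ((k + i : ℕ) : R))‖ ≤
      ‖(1 : R)‖ * ((‖D‖ + ‖(1 : R)‖ + 1) ^ n * n.factorial) := by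
  refine (norm_prod_le_norm_one_mul _ _).trans ?_
  gcongr
  rw [← Finset.prod_range_add_one_eq_factorial]
  push_cast
  rw [show (‖D‖ + ‖(1 : R)‖ + 1) ^ n = ∏ _k ∈ Finset.range n, (‖D‖ + ‖(1 : R)‖ + 1) by simp,
    ← Finset.prod_mul_distrib]
  refine Finset.prod_le_prod (fun _ _ => norm_nonneg _) fun k _ => ?_
  have h : ‖((k + i : ℕ) : R)‖ ≤ (k + 1) * ‖(1 : R)‖ := by
    rw [← mul_one ((k + i : ℕ) : R), ← nsmul_eq_mul]
    refine (norm_nsmul_le).trans ?_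
    gcongr
    exact_mod_cast (by omega : k + i ≤ k + 1)
  have h' := norm_sub_le D ((k + i : ℕ) : R)
  push_cast at h h' ⊢
  have := norm_nonneg D
  nlinarith [mul_nonneg this (Nat.cast_nonneg (α := ℝ) k)]

/-- With `c = k + 1`, the inverse of `D + c = c(1 + D/c)` is `c⁻¹` times a terminating geometric
series. As `|c| ≥ 1`, its norm is bounded independently of `k`. -/
theorem exists_norm_inverse_le [NormedAlgebra ℂ R] {D : R} (hD : IsNilpotent D) :
    ∃ C : ℝ, 0 ≤ C ∧ ∀ k : ℕ, ‖Ring.inverse (D + ((k + 1 : ℕ) : R))‖ ≤ C / (k + 1) := by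
  obtain ⟨N, hN⟩ := hD
  refine ⟨∑ j ∈ Finset.range N, ‖D ^ j‖, by positivity, fun k => ?_⟩
  have hc : ((k + 1 : ℕ) : ℂ) ≠ 0 := Nat.cast_ne_zero.2 k.succ_ne_zero
  set c : ℂ := ((k + 1 : ℕ) : ℂ) with hcdef
  set x : R := -(c⁻¹ • D) with hx
  have hxN : x ^ N = 0 := by rw [hx, neg_pow, smul_pow, hN, smul_zero, mul_zero]
  have hcn : ‖c‖ = k + 1 := by rw [hcdef, Complex.norm_natCast]; push_cast; rfl
  have hDc : D + ((k + 1 : ℕ) : R) = c • (1 - x) := by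
    rw [hx, sub_neg_eq_add, smul_add, smul_smul, mul_inv_cancel₀ hc, one_smul, hcdef, add_comm D,
      Algebra.smul_def, mul_one, map_natCast]
  have hmul : (D + ((k + 1 : ℕ) : R)) * (c⁻¹ • ∑ j ∈ Finset.range N, x ^ j) = 1 := by
    rw [hDc, smul_mul_smul_comm, mul_inv_cancel₀ hc, one_smul, mul_neg_geom_sum, hxN, sub_zero]
  have hu : IsUnit (D + ((k + 1 : ℕ) : R)) := IsUnit.of_mul_eq_one _ hmul
  have hinv : Ring.inverse (D + ((k + 1 : ℕ) : R)) = c⁻¹ • ∑ j ∈ Finset.range N, x ^ j := by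
    rw [← mul_one (Ring.inverse _), ← hmul, ← mul_assoc, Ring.inverse_mul_cancel _ hu, one_mul]
  rw [hinv, norm_smul, norm_inv, hcn, div_eq_inv_mul]
  gcongr
  refine (norm_sum_le _ _).trans (Finset.sum_le_sum fun j _ => ?_)
  rw [hx, ← neg_smul, smul_pow, norm_smul, norm_pow, norm_neg, norm_inv, hcn]
  refine mul_le_of_le_one_left (norm_nonneg _) (pow_le_one₀ (by positivity) ?_)
  exact inv_le_one_of_one_le₀ (by linarith [(Nat.cast_nonneg k : (0 : ℝ) ≤ k)])

theorem exists_norm_gammaQuot_le [NormedAlgebra ℂ R] {D : R} (hD : IsNilpotent D) :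
    ∃ C Q : ℝ, 0 ≤ C ∧ 1 ≤ Q ∧ ∀ m : ℤ, ‖gammaQuot D m‖ ≤ C * (Q ^ m.natAbs * gammaWeight m) := by
  obtain ⟨C, hC, h⟩ := exists_norm_inverse_le hD
  have hD0 := norm_nonneg D
  have h10 := norm_nonneg (1 : R)
  refine ⟨‖(1 : R)‖, ‖D‖ + ‖(1 : R)‖ + 1 + C, norm_nonneg _, by linarith, fun m => ?_⟩
  rcases lt_or_ge m 0 with hm | hm
  · have := norm_prod_range_le D 0 (-m).toNat zero_le_one
    rw [gammaQuot_of_neg hm, gammaWeight, Int.toNat_of_nonpos hm.le,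
      show m.natAbs = (-m).toNat by omega]
    simp only [add_zero] at this
    refine this.trans ?_
    simp only [Nat.factorial_zero, Nat.cast_one, div_one]
    have h1 : ‖D‖ + ‖(1 : R)‖ + 1 ≤ ‖D‖ + ‖(1 : R)‖ + 1 + C := by linarith
    gcongr
  · rw [gammaQuot_of_nonneg hm, gammaWeight, Int.toNat_of_nonpos (neg_nonpos.2 hm), inverse_prod,
      show m.natAbs = m.toNat by omega]
    refine (norm_prod_le_norm_one_mul _ _).trans ?_
    gcongr
    rw [← Finset.prod_range_add_one_eq_factorial m.toNat]
    push_cast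
    rw [show (‖D‖ + ‖(1 : R)‖ + 1 + C) ^ m.toNat =
      ∏ _k ∈ Finset.range m.toNat, (‖D‖ + ‖(1 : R)‖ + 1 + C) by simp, Nat.factorial_zero,
      Nat.cast_one, mul_one_div, ← Finset.prod_div_distrib]
    refine Finset.prod_le_prod (fun _ _ => norm_nonneg _) fun k _ => ?_
    have := h k
    push_cast at this
    refine this.trans ?_
    gcongr
    linarith

/-- A product of coefficients of exponents with a given sum grows at most exponentially. -/
theorem exists_norm_prod_le {ι : Type*} [Fintype ι] {g : ι → ℤ → R}
    (hg : ∀ v, ∃ C Q : ℝ, 0 ≤ C ∧ 1 ≤ Q ∧ ∀ m : ℤ, ‖g v m‖ ≤ C * (Q ^ m.natAbs * gammaWeight m)) :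
    ∃ Q : ℝ, 1 ≤ Q ∧ ∀ s : ℤ, ∃ C : ℝ, 0 ≤ C ∧ ∀ m : ι → ℤ, ∑ v, m v = s →
      ‖∏ v, g v (m v)‖ ≤ C * Q ^ ∑ v, (m v).natAbs := by
  classical
  choose C Q hC hQ h using hg
  have hQ' : ∀ v, Q v ≤ ∏ v, Q v := fun v => by
    rw [← Finset.mul_prod_erase _ _ (Finset.mem_univ v)]
    exact le_mul_of_one_le_right (by linarith [hQ v]) (Finset.one_le_prod fun w _ => hQ w)
  have hQ1 : 1 ≤ ∏ v, Q v := Finset.one_le_prod fun w _ => hQ w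
  refine ⟨(∏ v, Q v) * (2 * 2 ^ Fintype.card ι), ?_, fun s => ?_⟩
  · have : (1 : ℝ) ≤ 2 ^ Fintype.card ι := one_le_pow₀ (by norm_num)
    nlinarith
  obtain ⟨C', hC', h'⟩ := prod_gammaWeight_le (ι := ι) s
  refine ⟨‖(1 : R)‖ * (∏ v, C v) * C', by
    have := Finset.prod_nonneg (s := Finset.univ) fun v _ => hC v
    positivity, fun m hm => ?_⟩
  refine (norm_prod_le_norm_one_mul _ _).trans ?_
  rw [mul_assoc, mul_assoc]
  gcongr
  calc ∏ v, ‖g v (m v)‖ ≤ ∏ v, (C v * ((∏ v, Q v) ^ (m v).natAbs * gammaWeight (m v))) := by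
        refine Finset.prod_le_prod (fun _ _ => norm_nonneg _) fun v _ => (h v (m v)).trans ?_
        have := gammaWeight_nonneg (m v)
        have := hC v
        have := hQ v
        gcongr
        exact hQ' v
    _ = (∏ v, C v) * ((∏ v, Q v) ^ (∑ v, (m v).natAbs) * ∏ v, gammaWeight (m v)) := by
        rw [Finset.prod_mul_distrib, Finset.prod_mul_distrib, Finset.prod_pow_eq_pow_sum]
    _ ≤ (∏ v, C v) * ((∏ v, Q v) ^ (∑ v, (m v).natAbs) *
          (C' * (2 * 2 ^ Fintype.card ι) ^ ∑ v, (m v).natAbs)) := by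
        have := Finset.prod_nonneg (s := Finset.univ) fun v _ => hC v
        gcongr
        exact h' m hm
    _ = _ := by rw [mul_pow]; ring

end Estimates

/-! ### Laurent series in the variables `a_v` -/

section Laurent

variable {n : ℕ} {P : ReflexivePolytope n}

theorem laurent_add {a : P.Pt → ℂ} (ha : ∀ v, a v ≠ 0) (k m : P.Pt → ℤ) :
    laurent (k + m) a = laurent k a * laurent m a := by
  simp only [laurent, Pi.add_apply, ← Finset.prod_mul_distrib]
  exact Finset.prod_congr rfl fun v _ => zpow_add₀ (ha v) _ _

theorem laurent_single (a : P.Pt → ℂ) (v : P.Pt) : laurent (Pi.single v 1) a = a v := by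
  unfold laurent
  rw [Finset.prod_eq_single v]
  · simp
  · intro w _ hw
    simp [Pi.single_eq_of_ne hw]
  · simp

theorem mul_laurent_sub_single {a : P.Pt → ℂ} (ha : ∀ v, a v ≠ 0) (m : P.Pt → ℤ) (v : P.Pt) :
    a v * laurent (m - Pi.single v 1) a = laurent m a := by
  nth_rewrite 1 [← laurent_single a v]
  rw [← laurent_add ha, add_sub_cancel]

theorem relation_apply_eq_sum {r : ℕ} (l : Module.Basis (Fin r) ℤ (relationLattice P))
    (ℓ : relationLattice P) (v : P.Pt) : ℓ.1 v = ∑ j, l.repr ℓ j * (l j).1 v := by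
  have h := congrArg (fun x : relationLattice P => x.1 v) (l.sum_repr ℓ).symm
  simp only [Submodule.coe_sum, Finset.sum_apply, Submodule.coe_smul, Pi.smul_apply,
    smul_eq_mul] at h
  exact h

theorem laurent_eq_prod {r : ℕ} (l : Module.Basis (Fin r) ℤ (relationLattice P)) {a : P.Pt → ℂ}
    (ha : ∀ v, a v ≠ 0) (ℓ : relationLattice P) :
    laurent ℓ.1 a = ∏ j, laurent (l j).1 a ^ l.repr ℓ j := by
  have h := relation_apply_eq_sum l ℓ
  simp only [laurent, ← Finset.prod_zpow]
  rw [Finset.prod_comm]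
  refine Finset.prod_congr rfl fun v _ => ?_
  rw [h v]
  simp only [← zpow_mul]
  induction (Finset.univ : Finset (Fin r)) using Finset.induction_on with
  | empty => simp
  | insert j s hj ih => rw [Finset.sum_insert hj, Finset.prod_insert hj, zpow_add₀ (ha v), ih,
      mul_comm (l.repr ℓ j)]

theorem isOpen_forall_ne_zero {ι : Type*} [Finite ι] : IsOpen {a : ι → ℂ | ∀ v, a v ≠ 0} := by
  simp only [Set.ofPred_forall]
  exact isOpen_iInter_of_finite fun v => isOpen_ne.preimage (continuous_apply v)

theorem hasFDerivAt_laurent {a : P.Pt → ℂ} (ha : ∀ v, a v ≠ 0) (m : P.Pt → ℤ) :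
    HasFDerivAt (laurent m) (∑ v, ((m v : ℂ) * laurent (m - Pi.single v 1) a) •
      ContinuousLinearMap.proj (R := ℂ) (φ := fun _ : P.Pt => ℂ) v) a := by
  have h : ∀ v ∈ (Finset.univ : Finset P.Pt), HasFDerivAt (fun y : P.Pt → ℂ => y v ^ m v)
      (((m v : ℂ) * a v ^ (m v - 1)) •
        ContinuousLinearMap.proj (R := ℂ) (φ := fun _ : P.Pt => ℂ) v) a := fun v _ =>
    HasDerivAt.comp_hasFDerivAt (h₂ := fun z : ℂ => z ^ m v) (f := fun y : P.Pt → ℂ => y v) a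
      (hasDerivAt_zpow (m v) (a v) (Or.inl (ha v))) (hasFDerivAt_apply v a)
  have h2 := HasFDerivAt.finsetProd h
  unfold laurent
  convert! h2 using 1
  refine Finset.sum_congr rfl fun v _ => ?_
  rw [smul_smul, ← Finset.mul_prod_erase _ _ (Finset.mem_univ v), Pi.sub_apply, Pi.single_eq_same]
  congr 1
  rw [← mul_assoc, mul_comm]
  congr 1
  refine Finset.prod_congr rfl fun w hw => ?_
  rw [Pi.sub_apply, Pi.single_eq_of_ne (Finset.ne_of_mem_erase hw), sub_zero]

theorem continuousOn_laurent (m : P.Pt → ℤ) :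
    ContinuousOn (laurent m : (P.Pt → ℂ) → ℂ) {a | ∀ v, a v ≠ 0} := fun _ ha =>
  (hasFDerivAt_laurent ha m).continuousAt.continuousWithinAt

theorem summable_prod_pow (r : ℕ) {ρ : ℝ} (h0 : 0 ≤ ρ) (h1 : ρ < 1) :
    Summable fun k : Fin r → ℕ => ∏ j, ρ ^ k j := by
  induction r with
  | zero => exact (hasSum_fintype _).summable
  | succ r ih =>
    have h := (summable_geometric_of_lt_one h0 h1).mul_of_nonneg ih (fun _ => by positivity)
      (fun _ => Finset.prod_nonneg fun _ _ => by positivity)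
    rw [← (Fin.consEquiv fun _ => ℕ).summable_iff]
    refine h.congr fun x => ?_
    simp [Fin.prod_univ_succ, Fin.consEquiv]

variable {r : ℕ} (l : Module.Basis (Fin r) ℤ (relationLattice P))

/-- The growth of relations in terms of their coordinates. -/
def basisSize : ℕ := ∑ j, ∑ v, ((l j).1 v).natAbs

theorem sum_natAbs_le (ℓ : relationLattice P) :
    ∑ v, (ℓ.1 v).natAbs ≤ basisSize l * ∑ j, (l.repr ℓ j).natAbs := by
  have h := relation_apply_eq_sum l ℓ
  calc ∑ v, (ℓ.1 v).natAbs ≤ ∑ v, ∑ j, (l.repr ℓ j).natAbs * ((l j).1 v).natAbs := by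
        refine Finset.sum_le_sum fun v _ => ?_
        rw [h v]
        refine (Int.natAbs_sum_le _ _).trans ?_
        simp only [Int.natAbs_mul, le_refl]
    _ = ∑ j, (l.repr ℓ j).natAbs * ∑ v, ((l j).1 v).natAbs := by
        rw [Finset.sum_comm]
        simp only [Finset.mul_sum]
    _ ≤ ∑ j, (l.repr ℓ j).natAbs * basisSize l := by
        refine Finset.sum_le_sum fun j _ => Nat.mul_le_mul_left _ ?_
        exact Finset.single_le_sum (f := fun j => ∑ v, ((l j).1 v).natAbs)
          (fun _ _ => Nat.zero_le _) (Finset.mem_univ j)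
    _ = _ := by rw [← Finset.sum_mul, mul_comm]

/-- A radius of convergence for series with coefficients bounded by `Q ^ |ℓ|`. -/
def convRadius (Q : ℝ) : ℝ := ((2 * Q) ^ basisSize l)⁻¹

theorem convRadius_pos {Q : ℝ} (hQ : 1 ≤ Q) : 0 < convRadius l Q := by
  unfold convRadius; positivity

theorem isOpen_lcslNhd (ε : ℝ) : IsOpen (lcslNhd P l ε) := by
  have : lcslNhd P l ε = {a | ∀ v, a v ≠ 0} ∩
      ⋂ j, ({a | ∀ v, a v ≠ 0} ∩ (fun a => ‖laurent (l j).1 a‖) ⁻¹' Set.Iio ε) := by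
    ext a
    simp only [lcslNhd, Set.mem_ofPred_eq, Set.mem_inter_iff, Set.mem_iInter, Set.mem_preimage,
      Set.mem_Iio]
    exact ⟨fun h => ⟨h.1, fun j => ⟨h.1, h.2 j⟩⟩, fun h => ⟨h.1, fun j => (h.2 j).2⟩⟩
  rw [this]
  exact isOpen_forall_ne_zero.inter (isOpen_iInter_of_finite fun j =>
    (continuousOn_laurent _).norm.isOpen_inter_preimage isOpen_forall_ne_zero isOpen_Iio)

theorem exists_mem_lcslNhd_mul {ε : ℝ} (hε : 0 < ε) {a : P.Pt → ℂ} (ha : a ∈ lcslNhd P l ε) :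
    ∃ ρ : ℝ, 0 ≤ ρ ∧ ρ < 1 ∧ a ∈ lcslNhd P l (ρ * ε) := by
  obtain ⟨ha0, ha1⟩ := ha
  have h : ∀ j ∈ (Finset.univ : Finset (Fin r)), ‖laurent (l j).1 a‖ / ε < 1 := fun j _ =>
    (div_lt_one hε).2 (ha1 j)
  have h' : ∃ ρ : ℝ, 0 ≤ ρ ∧ ρ < 1 ∧ ∀ j ∈ (Finset.univ : Finset (Fin r)),
      ‖laurent (l j).1 a‖ / ε < ρ := by
    generalize (Finset.univ : Finset (Fin r)) = s at h
    induction s using Finset.induction_on with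
    | empty => exact ⟨0, le_rfl, one_pos, by simp⟩
    | insert j s hj ih =>
      obtain ⟨ρ, h0, h1, h2⟩ := ih fun i hi => h i (Finset.mem_insert_of_mem hi)
      obtain ⟨τ, h3, h4⟩ := exists_between (h j (Finset.mem_insert_self j s))
      refine ⟨max ρ τ, h0.trans (le_max_left _ _), max_lt h1 h4, fun i hi => ?_⟩
      rcases Finset.mem_insert.1 hi with rfl | hi
      · exact h3.trans_le (le_max_right _ _)
      · exact (h2 i hi).trans_le (le_max_left _ _)
  obtain ⟨ρ, h0, h1, h2⟩ := h'
  exact ⟨ρ, h0, h1, ha0, fun j => (div_lt_iff₀ hε).1 (h2 j (Finset.mem_univ j))⟩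

variable {E : Type*} [NormedAddCommGroup E]

/-- Coefficients of at most exponential growth, with support in a translated orthant. -/
structure IsDominated (Q : ℝ) (b : relationLattice P → E) : Prop where
  growth : ∃ C : ℝ, ∀ ℓ, ‖b ℓ‖ ≤ C * Q ^ ∑ v, (ℓ.1 v).natAbs
  support : ∃ K : ℕ, ∀ ℓ, b ℓ ≠ 0 → ∀ j, -(K : ℤ) ≤ l.repr ℓ j

/-- Locally uniform domination of a Laurent series with support in a translated orthant. -/
theorem exists_summable_bound {Q : ℝ} (hQ : 1 ≤ Q) {a : P.Pt → ℂ}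
    (ha : a ∈ lcslNhd P l (convRadius l Q)) :
    ∃ s : ℝ, 0 < s ∧ Metric.ball a s ⊆ lcslNhd P l (convRadius l Q) ∧
      ∀ b : relationLattice P → E, IsDominated l Q b → ∀ γ : P.Pt → ℤ,
        ∃ u : relationLattice P → ℝ, Summable u ∧ ∀ ℓ, ∀ y ∈ Metric.ball a s,
          2 ^ (∑ v, (ℓ.1 v).natAbs) * (‖laurent (γ + ℓ.1) y‖ * ‖b ℓ‖) ≤ u ℓ := by
  have hε := convRadius_pos l hQ
  -- Shrinking the radius by a factor `ρ < 1` leaves room for a geometric series in `ρ`, uniformly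
  -- on a closed ball around `a`.
  obtain ⟨ρ, hρ0, hρ1, haρ⟩ := exists_mem_lcslNhd_mul l hε ha
  obtain ⟨s, hs, hball⟩ := Metric.nhds_basis_closedBall.mem_iff.1
    ((isOpen_lcslNhd l _).mem_nhds haρ)
  have hmono : lcslNhd P l (ρ * convRadius l Q) ⊆ lcslNhd P l (convRadius l Q) := fun y hy =>
    ⟨hy.1, fun j => (hy.2 j).trans_le (mul_le_of_le_one_left hε.le hρ1.le)⟩
  refine ⟨s, hs, (Metric.ball_subset_closedBall.trans hball).trans hmono, ?_⟩
  rintro b ⟨⟨C, hb⟩, K, hsupp⟩ γ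
  -- Translation by `κ` moves the support of `b` into the nonnegative orthant. The monomial
  -- `a^{γ-κ}` is then a fixed factor, bounded on the compact ball.
  set κ : relationLattice P := (K : ℤ) • ∑ j, l j with hκ
  have hκr : ∀ j, l.repr κ j = K := fun j => by
    rw [hκ, map_smul, map_sum, Finsupp.smul_apply, Finsupp.finsetSum_apply]
    simp [Finsupp.single_apply]
  obtain ⟨B, hB⟩ := (isCompact_closedBall a s).exists_bound_of_continuousOn
    ((continuousOn_laurent (γ - κ.1)).mono fun y hy => (hball hy).1)
  have hB0 : 0 ≤ B := (norm_nonneg _).trans (hB a (Metric.mem_closedBall_self hs.le))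
  have hC0 : 0 ≤ C := by
    have := (norm_nonneg _).trans (hb 0)
    simpa using this
  set e : (Fin r → ℕ) → relationLattice P := fun k => (∑ j, (k j : ℤ) • l j) - κ with he
  have her : ∀ k j, l.repr (e k) j = k j - K := fun k j => by
    rw [he, map_sub, Finsupp.sub_apply, hκr, map_sum, Finsupp.finsetSum_apply]
    simp [Finsupp.single_apply]
  have hinj : Function.Injective e := fun k k' h => by
    ext j
    have := her k j
    rw [h, her k' j] at this
    omega
  set A : ℝ := C * B * (2 * Q) ^ ∑ v, (κ.1 v).natAbs with hA
  -- The majorant is extended by zero outside the translated orthant, where `b` vanishes.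
  set u : relationLattice P → ℝ := fun ℓ => Function.extend e (fun k => A * ∏ j, ρ ^ k j) 0 ℓ
  refine ⟨u, ?_, fun ℓ y hy => ?_⟩
  · refine (hinj.summable_iff ?_).1 ?_
    · intro ℓ hℓ
      exact Function.extend_apply' _ _ _ hℓ
    · refine ((summable_prod_pow r hρ0 hρ1).mul_left A).congr fun k => ?_
      simp [u, hinj.extend_apply]
  by_cases hbℓ : b ℓ = 0
  · rw [hbℓ, norm_zero, mul_zero, mul_zero]
    by_cases h : ∃ k, e k = ℓ
    · obtain ⟨k, rfl⟩ := h
      simp only [u, hinj.extend_apply]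
      have : 0 ≤ ∏ j, ρ ^ k j := Finset.prod_nonneg fun _ _ => by positivity
      positivity
    · simp only [u, Function.extend_apply' _ _ _ h]
      simp
  obtain ⟨k, rfl⟩ : ∃ k, e k = ℓ := by
    refine ⟨fun j => (l.repr ℓ j + K).toNat, l.repr.injective (Finsupp.ext fun j => ?_)⟩
    rw [her]
    have := hsupp ℓ hbℓ j
    omega
  simp only [u, hinj.extend_apply]
  have hyc := Metric.ball_subset_closedBall hy
  have hy' := hball hyc
  set w : relationLattice P := ∑ j, (k j : ℤ) • l j with hw
  have hwr : ∀ j, l.repr w j = k j := fun j => by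
    have h1 := her k j
    rw [show e k = w - κ from rfl, map_sub, Finsupp.sub_apply, hκr] at h1
    omega
  have hlau : ‖laurent (γ + (e k).1) y‖ ≤ B * ∏ j, (ρ * convRadius l Q) ^ k j := by
    have h1 : γ + (e k).1 = (γ - κ.1) + w.1 := by
      rw [show (e k).1 = w.1 - κ.1 from rfl]
      abel
    rw [h1, laurent_add hy'.1, norm_mul]
    refine mul_le_mul (hB y hyc) ?_ (norm_nonneg _) hB0
    rw [laurent_eq_prod l hy'.1, norm_prod]
    refine Finset.prod_le_prod (fun _ _ => norm_nonneg _) fun j _ => ?_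
    rw [hwr, zpow_natCast, norm_pow]
    exact pow_le_pow_left₀ (norm_nonneg _) (hy'.2 j).le _
  have hsize : ∑ v, ((e k).1 v).natAbs ≤ ∑ v, (κ.1 v).natAbs + basisSize l * ∑ j, k j := by
    have h1 : ∑ v, (w.1 v).natAbs ≤ basisSize l * ∑ j, k j := by
      refine (sum_natAbs_le l w).trans (le_of_eq ?_)
      simp [hwr]
    have h2 : ∑ v, ((e k).1 v).natAbs ≤ ∑ v, (κ.1 v).natAbs + ∑ v, (w.1 v).natAbs := by
      rw [← Finset.sum_add_distrib]
      refine Finset.sum_le_sum fun v _ => ?_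
      have : (e k).1 v = w.1 v - κ.1 v := rfl
      omega
    omega
  have h2Q : 1 ≤ 2 * Q := by linarith
  -- The radius `(2Q)^{-basisSize}` exactly cancels the growth. The factor `Q` pays for the
  -- coefficients, and the factor `2` for the weight `2^{|ℓ|}`, which later absorbs the integer
  -- factors produced by differentiation.
  have hprod : (2 * Q) ^ (basisSize l * ∑ j, k j) * ∏ j, (ρ * convRadius l Q) ^ k j =
      ∏ j, ρ ^ k j := by
    rw [pow_mul, ← Finset.prod_pow_eq_pow_sum, ← Finset.prod_mul_distrib]
    refine Finset.prod_congr rfl fun j _ => ?_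
    rw [← mul_pow, convRadius]
    congr 1
    field_simp
  have hp0 : 0 ≤ ∏ j, (ρ * convRadius l Q) ^ k j :=
    Finset.prod_nonneg fun _ _ => by positivity
  calc 2 ^ (∑ v, ((e k).1 v).natAbs) * (‖laurent (γ + (e k).1) y‖ * ‖b (e k)‖)
      ≤ 2 ^ (∑ v, ((e k).1 v).natAbs) * ((B * ∏ j, (ρ * convRadius l Q) ^ k j) *
          (C * Q ^ ∑ v, ((e k).1 v).natAbs)) := by
        gcongr
        exact hb _
    _ = C * B * (2 * Q) ^ (∑ v, ((e k).1 v).natAbs) * ∏ j, (ρ * convRadius l Q) ^ k j := by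
        rw [mul_pow]; ring
    _ ≤ C * B * (2 * Q) ^ (∑ v, (κ.1 v).natAbs + basisSize l * ∑ j, k j) *
          ∏ j, (ρ * convRadius l Q) ^ k j := by
        gcongr
    _ = A * ((2 * Q) ^ (basisSize l * ∑ j, k j) * ∏ j, (ρ * convRadius l Q) ^ k j) := by
        rw [pow_add, hA]; ring
    _ = _ := by rw [hprod]

end Laurent

/-! ### Termwise differentiation of Laurent series -/

section Series

variable {n : ℕ} {P : ReflexivePolytope n} {r : ℕ}
  {l : Module.Basis (Fin r) ℤ (relationLattice P)} {E : Type*} [NormedAddCommGroup E]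
  [NormedSpace ℂ E] [CompleteSpace E] {Q : ℝ} {b : relationLattice P → E}

/-- The Laurent series `∑_ℓ b_ℓ a^{γ + ℓ}`. -/
def laurentSeries (b : relationLattice P → E) (γ : P.Pt → ℤ) (a : P.Pt → ℂ) : E :=
  ∑' ℓ : relationLattice P, laurent (γ + ℓ.1) a • b ℓ

theorem summable_laurentSeries (hQ : 1 ≤ Q) (hb : IsDominated l Q b) (γ : P.Pt → ℤ)
    {a : P.Pt → ℂ} (ha : a ∈ lcslNhd P l (convRadius l Q)) :
    Summable fun ℓ : relationLattice P => laurent (γ + ℓ.1) a • b ℓ := by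
  obtain ⟨s, hs, -, h⟩ := exists_summable_bound (E := E) l hQ ha
  obtain ⟨u, hu, h⟩ := h b hb γ
  refine Summable.of_norm_bounded hu fun ℓ => ?_
  rw [norm_smul]
  refine le_trans ?_ (h ℓ a (Metric.mem_ball_self hs))
  exact le_mul_of_one_le_left (by positivity) (one_le_pow₀ (by norm_num))

/-- Differentiation in `a_v` brings down the factor `γ_v + ℓ_v`, bounded by `(|γ_v| + 1) 2^{|ℓ|}`,
so the weighted majorant of `exists_summable_bound` dominates the derivatives as well. -/
theorem hasFDerivAt_laurentSeries (hQ : 1 ≤ Q) (hb : IsDominated l Q b) (γ : P.Pt → ℤ)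
    {a : P.Pt → ℂ} (ha : a ∈ lcslNhd P l (convRadius l Q)) :
    ∃ F : (P.Pt → ℂ) →L[ℂ] E, HasFDerivAt (laurentSeries b γ) F a ∧ ∀ v,
      HasSum (fun ℓ : relationLattice P => (((γ v + ℓ.1 v : ℤ) : ℂ) *
        laurent (γ - Pi.single v 1 + ℓ.1) a) • b ℓ) (F (Pi.single v 1)) := by
  obtain ⟨s, hs, hball, h⟩ := exists_summable_bound (E := E) l hQ ha
  choose u hu h using fun γ => h b hb γ
  set f' : relationLattice P → (P.Pt → ℂ) → (P.Pt → ℂ) →L[ℂ] E := fun ℓ y =>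
    (∑ v, ((((γ + ℓ.1) v : ℤ) : ℂ) * laurent (γ + ℓ.1 - Pi.single v 1) y) •
      ContinuousLinearMap.proj (R := ℂ) (φ := fun _ : P.Pt => ℂ) v).smulRight (b ℓ) with hf'
  have hproj : ∀ v : P.Pt,
      ‖ContinuousLinearMap.proj (R := ℂ) (φ := fun _ : P.Pt => ℂ) v‖ ≤ 1 := fun v =>
    ContinuousLinearMap.opNorm_le_bound _ zero_le_one fun x => by
      rw [one_mul]; exact norm_le_pi_norm x v
  have hbound : ∀ ℓ, ∀ y ∈ Metric.ball a s,
      ‖f' ℓ y‖ ≤ ∑ v, ((γ v).natAbs + 1 : ℝ) * u (γ - Pi.single v 1) ℓ := by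
    intro ℓ y hy
    rw [hf', ContinuousLinearMap.norm_smulRight_apply]
    refine (mul_le_mul_of_nonneg_right (norm_sum_le _ _) (norm_nonneg _)).trans ?_
    rw [Finset.sum_mul]
    refine Finset.sum_le_sum fun v _ => ?_
    rw [norm_smul, norm_mul, Complex.norm_intCast, Pi.add_apply]
    have h1 := h (γ - Pi.single v 1) ℓ y hy
    have h2 : |((γ v + ℓ.1 v : ℤ) : ℝ)| ≤
        ((γ v).natAbs + 1 : ℝ) * 2 ^ (∑ v, (ℓ.1 v).natAbs) := by
      have h3 : (ℓ.1 v).natAbs < 2 ^ (∑ v, (ℓ.1 v).natAbs) :=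
        (Finset.single_le_sum (f := fun v => (ℓ.1 v).natAbs) (fun _ _ => Nat.zero_le _)
          (Finset.mem_univ v)).trans_lt Nat.lt_two_pow_self
      have h4 : 1 ≤ 2 ^ (∑ v, (ℓ.1 v).natAbs) := Nat.one_le_two_pow
      have h5 : (γ v + ℓ.1 v).natAbs ≤ ((γ v).natAbs + 1) * 2 ^ (∑ v, (ℓ.1 v).natAbs) := by
        have := Int.natAbs_add_le (γ v) (ℓ.1 v)
        nlinarith [Nat.mul_le_mul_left (γ v).natAbs h4]
      have h6 := (Nat.cast_le (α := ℝ)).2 h5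
      rw [Nat.cast_natAbs, Int.cast_abs, Nat.cast_mul, Nat.cast_add, Nat.cast_pow, Nat.cast_one,
        Nat.cast_ofNat] at h6
      exact h6
    have h6 : γ + ℓ.1 - Pi.single v 1 = γ - Pi.single v 1 + ℓ.1 := by abel
    rw [h6]
    calc |((γ v + ℓ.1 v : ℤ) : ℝ)| * ‖laurent (γ - Pi.single v 1 + ℓ.1) y‖ *
          ‖ContinuousLinearMap.proj (R := ℂ) (φ := fun _ : P.Pt => ℂ) v‖ * ‖b ℓ‖
        ≤ (((γ v).natAbs + 1 : ℝ) * 2 ^ (∑ v, (ℓ.1 v).natAbs)) *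
          ‖laurent (γ - Pi.single v 1 + ℓ.1) y‖ * 1 * ‖b ℓ‖ := by
          gcongr
          exact hproj v
      _ = ((γ v).natAbs + 1 : ℝ) * (2 ^ (∑ v, (ℓ.1 v).natAbs) *
          (‖laurent (γ - Pi.single v 1 + ℓ.1) y‖ * ‖b ℓ‖)) := by ring
      _ ≤ _ := by gcongr
  have hsum : Summable fun ℓ => ∑ v, ((γ v).natAbs + 1 : ℝ) * u (γ - Pi.single v 1) ℓ :=
    summable_sum fun v _ => (hu _).mul_left _
  have ha0 := Metric.mem_ball_self (x := a) hs
  have hder : ∀ ℓ y, y ∈ Metric.ball a s →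
      HasFDerivAt (fun y => laurent (γ + ℓ.1) y • b ℓ) (f' ℓ y) y := fun ℓ y hy =>
    (hasFDerivAt_laurent (hball hy).1 (γ + ℓ.1)).smul_const (b ℓ)
  refine ⟨∑' ℓ, f' ℓ a, hasFDerivAt_tsum_of_isPreconnected hsum Metric.isOpen_ball
    (convex_ball a s).isPreconnected hder hbound ha0 (summable_laurentSeries hQ hb γ ha) ha0,
    fun v => ?_⟩
  have hs' : Summable fun ℓ => f' ℓ a := Summable.of_norm_bounded hsum fun ℓ => hbound ℓ a ha0
  have := (ContinuousLinearMap.apply ℂ E (Pi.single v (1 : ℂ) : P.Pt → ℂ)).hasSum hs'.hasSum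
  simp only [ContinuousLinearMap.apply_apply] at this
  convert! this using 1
  funext ℓ
  rw [hf', ContinuousLinearMap.smulRight_apply, sum_apply,
    Finset.sum_eq_single v]
  · rw [smul_apply, ContinuousLinearMap.proj_apply, Pi.single_eq_same,
      smul_eq_mul, mul_one, Pi.add_apply, add_sub_right_comm]
  · intro w _ hw
    rw [smul_apply, ContinuousLinearMap.proj_apply, Pi.single_eq_of_ne hw,
      smul_zero]
  · simp

end Series

/-! ### The hypergeometric series and its contiguity relations -/

section HyperSeries

variable {n : ℕ} {P : ReflexivePolytope n}

/-- Differentiating `exp (lg a v) = a v` determines the derivative, so the choice of branch plays no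
role. -/
theorem IsLogBranch.hasFDerivAt {U : Set (P.Pt → ℂ)} {lg : (P.Pt → ℂ) → P.Pt → ℂ}
    (h : IsLogBranch U lg) (hU : IsOpen U) {a : P.Pt → ℂ} (ha : a ∈ U) (v : P.Pt) :
    HasFDerivAt (fun y => lg y v)
      ((a v)⁻¹ • ContinuousLinearMap.proj (R := ℂ) (φ := fun _ : P.Pt => ℂ) v) a := by
  have h1 : DifferentiableAt ℂ (fun y => lg y v) a :=
    differentiableAt_pi.1 (h.holomorphic.differentiableAt (hU.mem_nhds ha)) v
  have h2 := h1.hasFDerivAt.cexp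
  have h3 : (fun y => Complex.exp (lg y v)) =ᶠ[nhds a] fun y => y v := by
    filter_upwards [hU.mem_nhds ha] with y hy using h.exp_eq y hy v
  have h4 := h2.unique ((hasFDerivAt_apply (𝕜 := ℂ) v a).congr_of_eventuallyEq h3)
  rw [h.exp_eq a ha v] at h4
  have h5 : a v ≠ 0 := by
    rw [← h.exp_eq a ha v]; exact Complex.exp_ne_zero _
  have h6 := h1.hasFDerivAt
  rwa [← h4, smul_smul, inv_mul_cancel₀ h5, one_smul]

variable {R : Type*} [NormedCommRing R] [NormedAlgebra ℂ R] [CompleteSpace R]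

theorem IsLogBranch.hasFDerivAt_exp {U : Set (P.Pt → ℂ)} {lg : (P.Pt → ℂ) → P.Pt → ℂ}
    (h : IsLogBranch U lg) (hU : IsOpen U) {a : P.Pt → ℂ} (ha : a ∈ U) (D : P.Pt → R) :
    ∃ F : (P.Pt → ℂ) →L[ℂ] R,
      HasFDerivAt (fun y => NormedSpace.exp (∑ v, lg y v • D v)) F a ∧
      ∀ v, F (Pi.single v 1) = (a v)⁻¹ • (D v * NormedSpace.exp (∑ v, lg a v • D v)) := by
  have h1 : HasFDerivAt (fun y => ∑ v, lg y v • D v)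
      (∑ v, ((a v)⁻¹ • ContinuousLinearMap.proj (R := ℂ) (φ := fun _ : P.Pt => ℂ) v).smulRight
        (D v)) a := HasFDerivAt.fun_sum fun v _ => (h.hasFDerivAt hU ha v).smul_const (D v)
  refine ⟨_, (_root_.hasFDerivAt_exp (𝕂 := ℂ)).comp a h1, fun v => ?_⟩
  have h2 : (∑ v, ((a v)⁻¹ • ContinuousLinearMap.proj (R := ℂ) (φ := fun _ : P.Pt => ℂ) v).smulRight
      (D v)) (Pi.single v 1) = (a v)⁻¹ • D v := by
    rw [sum_apply, Finset.sum_eq_single v]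
    · simp
    · intro w _ hw
      simp [Pi.single_eq_of_ne hw]
    · simp
  rw [ContinuousLinearMap.comp_apply, h2, smul_apply, one_apply_eq_self, smul_eq_mul,
    mul_smul_comm, mul_comm]

/-- The hypergeometric series `∑_ℓ ∏_v Γ(D_v + 1) / Γ(D_v + m_v + 1) a^{m + D}`, the sum being over
`m ∈ γ + L`. -/
def hyperSeries (D : P.Pt → R) (lg : (P.Pt → ℂ) → P.Pt → ℂ) (γ : P.Pt → ℤ) (a : P.Pt → ℂ) : R :=
  laurentSeries (fun ℓ => gammaCoeff D (γ + ℓ.1)) γ a * NormedSpace.exp (∑ v, lg a v • D v)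

omit [CompleteSpace R] in
-- Both sums run over the same coset of `L`, and the summand depends only on the exponent. This
-- gives the box equations and the rewriting of the root operators.
theorem hyperSeries_eq_of_sub_mem (D : P.Pt → R) (lg : (P.Pt → ℂ) → P.Pt → ℂ) {γ δ : P.Pt → ℤ}
    (h : γ - δ ∈ relationLattice P) : hyperSeries D lg γ = hyperSeries D lg δ := by
  funext a
  unfold hyperSeries laurentSeries
  congr 1
  rw [← (Equiv.addRight (⟨γ - δ, h⟩ : relationLattice P)).tsum_eq
    fun ℓ : relationLattice P => laurent (δ + ℓ.1) a • gammaCoeff D (δ + ℓ.1)]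
  refine tsum_congr fun ℓ => ?_
  have : δ + ((Equiv.addRight (⟨γ - δ, h⟩ : relationLattice P)) ℓ).1 = γ + ℓ.1 := by
    change δ + (ℓ.1 + (γ - δ)) = γ + ℓ.1
    abel
  rw [this]

variable {D : P.Pt → R} (hD : ∀ v, IsNilpotent (D v)) {r : ℕ}
  {l : Module.Basis (Fin r) ℤ (relationLattice P)} {Q : ℝ} (hQ : 1 ≤ Q)
  (hdom : ∀ γ : P.Pt → ℤ,
    IsDominated l Q fun ℓ : relationLattice P => gammaCoeff D (γ + ℓ.1))

include hD hQ hdom in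
theorem hasSum_mul_laurentSeries (γ : P.Pt → ℤ) {a : P.Pt → ℂ}
    (ha : a ∈ lcslNhd P l (convRadius l Q)) (v : P.Pt) :
    HasSum (fun ℓ : relationLattice P => laurent (γ + ℓ.1) a •
      ((D v + ((γ v + ℓ.1 v : ℤ) : R)) * gammaCoeff D (γ + ℓ.1)))
      (a v • laurentSeries (fun ℓ => gammaCoeff D (γ - Pi.single v 1 + ℓ.1))
        (γ - Pi.single v 1) a) := by
  have h := (summable_laurentSeries hQ (hdom (γ - Pi.single v 1)) (γ - Pi.single v 1)
    ha).hasSum.const_smul (a v)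
  convert! h using 1
  funext ℓ
  rw [← add_sub_right_comm, gammaCoeff_sub_single hD, smul_smul, mul_laurent_sub_single ha.1,
    Pi.add_apply]

include hD hQ hdom in
-- By the product rule the Laurent monomial contributes `m_v` and the exponential contributes `D_v`.
-- The total factor `D_v + m_v` turns the coefficient at `m` into the one at `m - e_v`.
theorem hasFDerivAt_hyperSeries {U : Set (P.Pt → ℂ)} (hU : IsOpen U)
    (hUl : U ⊆ lcslNhd P l (convRadius l Q)) {lg : (P.Pt → ℂ) → P.Pt → ℂ} (hlg : IsLogBranch U lg)
    (γ : P.Pt → ℤ) {a : P.Pt → ℂ} (ha : a ∈ U) :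
    ∃ F : (P.Pt → ℂ) →L[ℂ] R, HasFDerivAt (hyperSeries D lg γ) F a ∧
      ∀ v, F (Pi.single v 1) = hyperSeries D lg (γ - Pi.single v 1) a := by
  have ha' := hUl ha
  obtain ⟨F, hF, hF'⟩ := hasFDerivAt_laurentSeries hQ (hdom γ) γ ha'
  obtain ⟨G, hG, hG'⟩ := hlg.hasFDerivAt_exp hU ha D
  refine ⟨_, hF.mul hG, fun v => ?_⟩
  set S := laurentSeries (fun ℓ => gammaCoeff D (γ + ℓ.1)) γ a
  set X := NormedSpace.exp (∑ v, lg a v • D v) with hX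
  have hav : a v ≠ 0 := ha'.1 v
  have h1 : F (Pi.single v 1) + (a v)⁻¹ • (S * D v) =
      laurentSeries (fun ℓ => gammaCoeff D (γ - Pi.single v 1 + ℓ.1)) (γ - Pi.single v 1) a := by
    have h2 := ((summable_laurentSeries hQ (hdom γ) γ ha').hasSum.mul_right (D v)).const_smul
      (a v)⁻¹
    have h3 := (hasSum_mul_laurentSeries hD hQ hdom γ ha' v).const_smul (a v)⁻¹
    rw [smul_smul, inv_mul_cancel₀ hav, one_smul] at h3
    refine ((hF' v).add h2).unique ?_
    convert! h3 using 1
    funext ℓ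
    rw [← mul_laurent_sub_single ha'.1 (γ + ℓ.1) v, smul_smul, ← mul_assoc, inv_mul_cancel₀ hav,
      one_mul, smul_mul_assoc, smul_smul, ← mul_assoc, inv_mul_cancel₀ hav, one_mul,
      ← add_sub_right_comm, add_mul, smul_add, mul_comm (D v), add_comm, mul_comm (_ : ℂ), mul_smul,
      ← zsmul_eq_mul, Int.cast_smul_eq_zsmul]
  rw [add_apply, smul_apply, smul_apply, hG', hyperSeries, ← h1, ← hX, smul_eq_mul, smul_eq_mul,
    add_mul, mul_smul_comm, smul_mul_assoc]
  rw [← mul_assoc S, mul_comm X, add_comm]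

include hD hQ hdom in
-- Each operation `a_v · Φ_{δ-e_v}` multiplies the term at `m` by `D_v + m_v`. The hypotheses say
-- that `∑ β_v (D_v + m_v)` equals the scalar `κ` for every `m ∈ δ + L`.
theorem sum_smul_hyperSeries {lg : (P.Pt → ℂ) → P.Pt → ℂ} {β : P.Pt → ℂ} {κ : ℂ} {δ : P.Pt → ℤ}
    (hβL : ∀ ℓ ∈ relationLattice P, ∑ v, β v * (ℓ v : ℂ) = 0)
    (hβδ : ∑ v, β v * (δ v : ℂ) = κ) (hβD : ∑ v, β v • D v = 0) {a : P.Pt → ℂ}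
    (ha : a ∈ lcslNhd P l (convRadius l Q)) :
    ∑ v, (β v * a v) • hyperSeries D lg (δ - Pi.single v 1) a = κ • hyperSeries D lg δ a := by
  unfold hyperSeries
  have h : ∑ v, β v • a v • laurentSeries (fun ℓ => gammaCoeff D (δ - Pi.single v 1 + ℓ.1))
      (δ - Pi.single v 1) a = κ • laurentSeries (fun ℓ => gammaCoeff D (δ + ℓ.1)) δ a := by
    have h1 := hasSum_sum (s := Finset.univ) fun v _ =>
      (hasSum_mul_laurentSeries hD hQ hdom δ ha v).const_smul (β v)
    have h2 := (summable_laurentSeries hQ (hdom δ) δ ha).hasSum.const_smul κ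
    refine h1.unique ?_
    convert! h2 using 1
    funext ℓ
    have h3 : ∑ v, β v • (D v + ((δ v + ℓ.1 v : ℤ) : R)) = κ • (1 : R) := by
      have h4 : ∀ v, β v • (D v + ((δ v + ℓ.1 v : ℤ) : R)) =
          β v • D v + (β v * (δ v : ℂ) + β v * (ℓ.1 v : ℂ)) • (1 : R) := fun v => by
        rw [smul_add, ← mul_add, mul_smul]
        congr 2
        rw [Algebra.smul_def, mul_one]
        push_cast
        simp
      simp only [h4, Finset.sum_add_distrib]
      rw [hβD, ← Finset.sum_smul, Finset.sum_add_distrib, hβδ, hβL _ ℓ.2, add_zero, zero_add]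
    calc ∑ v, β v • laurent (δ + ℓ.1) a • ((D v + ((δ v + ℓ.1 v : ℤ) : R)) * gammaCoeff D (δ + ℓ.1))
        = laurent (δ + ℓ.1) a •
          ((∑ v, β v • (D v + ((δ v + ℓ.1 v : ℤ) : R))) * gammaCoeff D (δ + ℓ.1)) := by
          rw [Finset.sum_mul, Finset.smul_sum]
          refine Finset.sum_congr rfl fun v _ => ?_
          rw [smul_comm, smul_mul_assoc]
      _ = _ := by
          rw [h3, smul_mul_assoc, one_mul, smul_comm]
  rw [← smul_mul_assoc, ← h, Finset.sum_mul]
  refine Finset.sum_congr rfl fun v _ => ?_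
  rw [smul_smul, smul_mul_assoc]

end HyperSeries

/-! ### The differential equations for scalar coefficient functions -/

section Solutions

variable {n : ℕ} {P : ReflexivePolytope n} {R : Type*} [NormedCommRing R] [NormedAlgebra ℂ R]
  [CompleteSpace R] {D : P.Pt → R} (hD : ∀ v, IsNilpotent (D v)) {r : ℕ}
  {l : Module.Basis (Fin r) ℤ (relationLattice P)} {Q : ℝ} (hQ : 1 ≤ Q)
  (hdom : ∀ γ : P.Pt → ℤ,
    IsDominated l Q fun ℓ : relationLattice P => gammaCoeff D (γ + ℓ.1))
  {U : Set (P.Pt → ℂ)} (hU : IsOpen U) (hUl : U ⊆ lcslNhd P l (convRadius l Q))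
  {lg : (P.Pt → ℂ) → P.Pt → ℂ} (hlg : IsLogBranch U lg) (φ : R →L[ℂ] ℂ)

include hD hQ hdom hU hUl hlg in
theorem partialDeriv_eqOn {f : (P.Pt → ℂ) → ℂ} {γ : P.Pt → ℤ}
    (hf : Set.EqOn f (fun a => φ (hyperSeries D lg γ a)) U) (v : P.Pt) :
    Set.EqOn (partialDeriv v f) (fun a => φ (hyperSeries D lg (γ - Pi.single v 1) a)) U := by
  intro a ha
  obtain ⟨F, hF, hF'⟩ := hasFDerivAt_hyperSeries hD hQ hdom hU hUl hlg γ ha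
  have h1 : HasFDerivAt f (φ.comp F) a :=
    (φ.hasFDerivAt.comp a hF).congr_of_eventuallyEq (hf.eventuallyEq_of_mem (hU.mem_nhds ha))
  rw [partialDeriv, h1.fderiv, ContinuousLinearMap.comp_apply, hF']

include hD hQ hdom hU hUl hlg in
theorem mixedDeriv_eqOn {f : (P.Pt → ℂ) → ℂ} {γ : P.Pt → ℤ}
    (hf : Set.EqOn f (fun a => φ (hyperSeries D lg γ a)) U) (k : P.Pt → ℕ) :
    Set.EqOn (mixedDeriv k f) (fun a => φ (hyperSeries D lg (γ - fun v => (k v : ℤ)) a)) U := by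
  have h1 : ∀ (m : ℕ) (v : P.Pt) (g : (P.Pt → ℂ) → ℂ) (δ : P.Pt → ℤ),
      Set.EqOn g (fun a => φ (hyperSeries D lg δ a)) U →
      Set.EqOn ((partialDeriv v)^[m] g)
        (fun a => φ (hyperSeries D lg (δ - Pi.single v (m : ℤ)) a)) U := by
    intro m v g δ hg
    induction m with
    | zero => simpa using hg
    | succ m ih =>
      rw [Function.iterate_succ_apply']
      have := partialDeriv_eqOn hD hQ hdom hU hUl hlg φ ih v
      rwa [sub_sub, ← Pi.single_add, ← Nat.cast_succ] at this
  have h2 : ∀ t : List P.Pt, Set.EqOn (t.foldr (fun v g => (partialDeriv v)^[k v] g) f)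
      (fun a => φ (hyperSeries D lg (γ - (t.map fun v => Pi.single v (k v : ℤ)).sum) a)) U := by
    intro t
    induction t with
    | nil => simpa using hf
    | cons v t ih =>
      have := h1 (k v) v _ _ ih
      rw [List.foldr_cons, List.map_cons, List.sum_cons, add_comm]
      rwa [sub_sub] at this
  have h3 := h2 (Finset.univ : Finset P.Pt).toList
  rw [Finset.sum_map_toList] at h3
  have h4 : ∑ v : P.Pt, Pi.single v (k v : ℤ) = fun v => (k v : ℤ) :=
    Finset.univ_sum_single fun v => (k v : ℤ)
  rwa [h4] at h3

theorem mem_relationLattice_iff {ℓ : P.Pt → ℤ} :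
    ℓ ∈ relationLattice P ↔ (∀ j : Fin n, ∑ v, ℓ v * v.1 j = 0) ∧ ∑ v, ℓ v = 0 := Iff.rfl

theorem single_sub_single_mem_relationLattice {v w v' w' : P.Pt}
    (h : v.1 + w.1 = v'.1 + w'.1) :
    Pi.single v 1 + Pi.single w 1 - (Pi.single v' 1 + Pi.single w' 1) ∈ relationLattice P := by
  refine mem_relationLattice_iff.2 ⟨fun j => ?_, ?_⟩
  · have := congrFun h j
    simp only [Pi.add_apply] at this
    simp only [Pi.sub_apply, Pi.add_apply, sub_mul, add_mul, Finset.sum_sub_distrib,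
      Finset.sum_add_distrib, Pi.single_apply, ite_mul, one_mul, zero_mul, Finset.sum_ite_eq',
      Finset.mem_univ, if_true]
    omega
  · simp [Finset.sum_add_distrib, Pi.single_apply]

include hD hQ hdom hU hUl hlg in
theorem isGKZSolution_of_eqOn (hsum : ∑ v, D v = 0)
    (hlin : ∀ j : Fin n, ∑ v : P.Pt, (v.1 j : ℂ) • D v = 0) {f : (P.Pt → ℂ) → ℂ}
    (hf : Set.EqOn f (fun a => φ (hyperSeries D lg (-Pi.single P.origin 1) a)) U) :
    IsGKZSolution P U f where
  holomorphic := fun a ha => by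
    obtain ⟨F, hF, -⟩ := hasFDerivAt_hyperSeries hD hQ hdom hU hUl hlg (-Pi.single P.origin 1) ha
    exact ((φ.hasFDerivAt.comp a hF).congr_of_eventuallyEq
      (hf.eventuallyEq_of_mem (hU.mem_nhds ha))).differentiableAt.differentiableWithinAt
  box := fun ℓ hℓ a ha => by
    rw [mixedDeriv_eqOn hD hQ hdom hU hUl hlg φ hf _ ha,
      mixedDeriv_eqOn hD hQ hdom hU hUl hlg φ hf _ ha, sub_eq_zero]
    dsimp only
    rw [hyperSeries_eq_of_sub_mem D lg]
    -- The two sides of the box equation are the shifts of `-e_0` by the positive and the negative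
    -- part of `ℓ`, which differ by `-ℓ ∈ L`.
    have h1 : (-Pi.single P.origin 1 - fun v => ((ℓ v).toNat : ℤ)) -
        (-Pi.single P.origin 1 - fun v => ((-ℓ v).toNat : ℤ)) = -ℓ := by
      funext v
      simp only [Pi.sub_apply, Pi.neg_apply]
      omega
    rw [h1]
    exact neg_mem hℓ
  torus := fun j a ha => by
    have h := sum_smul_hyperSeries hD hQ hdom (lg := lg) (β := fun v => (v.1 j : ℂ)) (κ := 0)
      (δ := -Pi.single P.origin 1)
      (fun ℓ hℓ => by
        have := (mem_relationLattice_iff.1 hℓ).1 j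
        simp only [mul_comm (ℓ _)] at this
        exact_mod_cast this)
      (by simp [Pi.single_apply, ReflexivePolytope.origin]) (hlin j) (hUl ha)
    have h2 := congrArg φ h
    rw [map_sum, zero_smul, map_zero] at h2
    rw [← h2]
    refine Finset.sum_congr rfl fun v _ => ?_
    rw [map_smul, smul_eq_mul, partialDeriv_eqOn hD hQ hdom hU hUl hlg φ hf v ha]
  euler := fun a ha => by
    have h := sum_smul_hyperSeries hD hQ hdom (lg := lg) (β := fun _ => 1) (κ := -1)
      (δ := -Pi.single P.origin 1)
      (fun ℓ hℓ => by
        have := (mem_relationLattice_iff.1 hℓ).2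
        simp only [one_mul]
        exact_mod_cast this)
      (by simp [Pi.single_apply]) (by simpa using hsum) (hUl ha)
    have h2 := congrArg φ h
    rw [map_sum, map_smul, smul_eq_mul, neg_one_mul] at h2
    rw [hf ha, ← eq_neg_iff_add_eq_zero, ← h2]
    refine Finset.sum_congr rfl fun v _ => ?_
    rw [map_smul, smul_eq_mul, one_mul, partialDeriv_eqOn hD hQ hdom hU hUl hlg φ hf v ha]

include hD hQ hdom hU hUl hlg in
-- The first order relation is applied with `δ = -e_v`, not `-e_0`: the relation `v + v' = 0 + w`
-- identifies `Φ_{-e_0-e_w}` with `Φ_{-e_v-e_{v'}}`. The constant is `-(⟨v,u⟩ + 1) = 0` because `v`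
-- lies on the facet.
theorem rootOperator_eq_zero_of_eqOn (hsum : ∑ v, D v = 0)
    (hlin : ∀ j : Fin n, ∑ v : P.Pt, (v.1 j : ℂ) • D v = 0) {f : (P.Pt → ℂ) → ℂ}
    (hf : Set.EqOn f (fun a => φ (hyperSeries D lg (-Pi.single P.origin 1) a)) U)
    {u : Fin n → ℤ} {v : P.Pt} (hv : v.1 ⬝ᵥ u = -1)
    (hadd : ∀ v' : P.Pt, v'.1 ⬝ᵥ u ≠ -1 → ∃ w : P.Pt, w.1 = v'.1 + v.1) {a : P.Pt → ℂ}
    (ha : a ∈ U) : rootOperator P u v.1 f a = 0 := by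
  have h := sum_smul_hyperSeries hD hQ hdom (lg := lg)
    (β := fun v' => ((v'.1 ⬝ᵥ u + 1 : ℤ) : ℂ)) (κ := 0) (δ := -Pi.single v 1)
    (fun ℓ hℓ => by
      obtain ⟨h1, h2⟩ := mem_relationLattice_iff.1 hℓ
      have h3 : ∑ v' : P.Pt, (v'.1 ⬝ᵥ u + 1) * ℓ v' = 0 := by
        simp only [add_mul, one_mul, Finset.sum_add_distrib, h2, add_zero, dotProduct,
          Finset.sum_mul]
        rw [Finset.sum_comm]
        refine Finset.sum_eq_zero fun j _ => ?_
        rw [← mul_zero (u j), ← h1 j, Finset.mul_sum]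
        exact Finset.sum_congr rfl fun v _ => by ring
      exact_mod_cast h3)
    (by simp [Pi.single_apply, hv])
    (by
      simp only [Int.cast_add, Int.cast_one, add_smul, one_smul, Finset.sum_add_distrib, hsum,
        add_zero, dotProduct, Int.cast_sum, Int.cast_mul, Finset.sum_smul]
      rw [Finset.sum_comm]
      refine Finset.sum_eq_zero fun j _ => ?_
      rw [← smul_zero (u j : ℂ), ← hlin j, Finset.smul_sum]
      exact Finset.sum_congr rfl fun v _ => by rw [smul_smul, mul_comm])
    (hUl ha)
  have h2 := congrArg φ h
  rw [map_sum, zero_smul, map_zero] at h2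
  rw [← h2, rootOperator]
  refine Finset.sum_congr rfl fun v' _ => ?_
  -- On the facet the inner sum is empty and the coefficient `⟨v',u⟩ + 1` is zero, so restricting to
  -- `v' ∉ F_u` loses nothing.
  by_cases hv' : v'.1 ⬝ᵥ u = -1
  · simp [hv']
  obtain ⟨w, hw⟩ := hadd v' hv'
  have h3 : (Finset.univ.filter fun w : P.Pt => v'.1 ⬝ᵥ u ≠ -1 ∧ w.1 = v'.1 + v.1) = {w} := by
    ext x
    simp only [Finset.mem_filter, Finset.mem_univ, true_and, Finset.mem_singleton]
    exact ⟨fun hx => Subtype.ext (hx.2.trans hw.symm), fun hx => ⟨hv', hx ▸ hw⟩⟩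
  rw [h3, Finset.sum_singleton, map_smul, smul_eq_mul,
    partialDeriv_eqOn hD hQ hdom hU hUl hlg φ hf w ha]
  dsimp only
  rw [hyperSeries_eq_of_sub_mem D lg (δ := -Pi.single v 1 - Pi.single v' 1)]
  have h4 := single_sub_single_mem_relationLattice (P := P) (v := v) (w := v') (v' := P.origin)
    (w' := w) (by rw [hw, add_comm]; simp [ReflexivePolytope.origin])
  convert h4 using 1
  abel

end Solutions

/-! ### Simplices of the triangulation and the Mori cone -/

section Geometry

variable {n : ℕ} {P : ReflexivePolytope n} {T : Geometry.SimplicialComplex ℝ (Fin n → ℝ)}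

theorem toReal_injective : Function.Injective (toReal : (Fin n → ℤ) → Fin n → ℝ) := fun v w h => by
  funext k
  simpa [toReal] using congrFun h k

theorem toReal_zero : toReal (0 : Fin n → ℤ) = 0 := by
  ext; simp [toReal]

theorem toReal_dotProduct (v w : Fin n → ℤ) : toReal v ⬝ᵥ toReal w = ((v ⬝ᵥ w : ℤ) : ℝ) := by
  simp [dotProduct, toReal]

/-- Vertices of a face are affinely independent, hence at most `n + 1` in number, so a chain of
faces must stop. -/
theorem exists_facet_superset {s : Finset (Fin n → ℝ)} (hs : s ∈ T.faces) :
    ∃ t ∈ T.facets, s ⊆ t := by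
  have hcard : ∀ t ∈ T.faces, t.card ≤ n + 1 := fun t ht => by
    have := (T.indep ht).card_le_finrank_succ
    have h2 : Module.finrank ℝ (vectorSpan ℝ (Set.range ((↑) : t → Fin n → ℝ))) ≤ n :=
      (Submodule.finrank_le _).trans (by simp)
    rw [Fintype.card_coe] at this
    omega
  by_contra! hcon
  have h : ∀ k : ℕ, ∃ t ∈ T.faces, s ⊆ t ∧ k ≤ t.card := by
    intro k
    induction k with
    | zero => exact ⟨s, hs, subset_rfl, Nat.zero_le _⟩
    | succ k ih =>
      obtain ⟨t, ht, hst, hk⟩ := ih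
      have h1 : t ∉ T.facets := fun h => hcon t h hst
      obtain ⟨t', ht', htt'⟩ := (Geometry.SimplicialComplex.not_facet_iff_subface ht).1 h1
      exact ⟨t', ht', hst.trans htt'.1, hk.trans_lt (Finset.card_lt_card htt')⟩
  obtain ⟨t, ht, -, hk⟩ := h (n + 2)
  have := hcard t ht
  omega

variable (hT : IsRegularProjective P T)

include hT in
theorem exists_facet : ∃ s, s ∈ T.facets := by
  have h : (0 : Fin n → ℝ) ∈ T.space := by
    rw [hT.space_eq, ← toReal_zero]
    exact P.origin.2
  obtain ⟨s, hs, -⟩ := Geometry.SimplicialComplex.mem_space_iff.1 h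
  obtain ⟨t, ht, -⟩ := exists_facet_superset hs
  exact ⟨t, ht⟩

include hT in
theorem mem_carrier_of_mem_facet {s : Finset (Fin n → ℝ)} (hs : s ∈ T.facets) {x : Fin n → ℝ}
    (hx : x ∈ s) : x ∈ P.carrier := by
  rw [← hT.space_eq]
  exact T.subset_space (T.facets_subset hs) hx

include hT in
/-- The vertices of a maximal simplex, as lattice points of the polytope. -/
theorem exists_basis_of_facet {s : Finset (Fin n → ℝ)} (hs : s ∈ T.facets) :
    ∃ (b : Module.Basis (Fin n) ℤ (Fin n → ℤ)) (p : Fin n → P.Pt), (∀ k, (p k).1 = b k) ∧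
      ∀ v : P.Pt, toReal v.1 ∈ s ↔ v = P.origin ∨ ∃ k, v = p k := by
  obtain ⟨b, hb⟩ := hT.regular s hs
  have hmem : ∀ k, toReal (b k) ∈ s := fun k => by
    rw [← Finset.mem_coe, hb]
    exact Or.inr ⟨k, rfl⟩
  refine ⟨b, fun k => ⟨b k, mem_carrier_of_mem_facet hT hs (hmem k)⟩, fun k => rfl, fun v => ?_⟩
  rw [← Finset.mem_coe, hb, Set.mem_insert_iff, Set.mem_range, ← toReal_zero (n := n)]
  refine or_congr ⟨fun h => Subtype.ext (toReal_injective h), fun h => h ▸ rfl⟩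
    (exists_congr fun k => ⟨fun h => Subtype.ext (toReal_injective h.symm), fun h => h ▸ rfl⟩)

include hT in
theorem finite_facets : T.facets.Finite := by
  classical
  refine (Finset.finite_toSet
    (Finset.univ.image fun v : P.Pt => toReal v.1).powerset).subset fun s hs => ?_
  rw [Finset.mem_coe, Finset.mem_powerset]
  intro x hx
  obtain ⟨b, hb⟩ := hT.regular s hs
  have hx' : x ∈ (s : Set (Fin n → ℝ)) := hx
  have hxc := mem_carrier_of_mem_facet hT hs hx
  rw [hb] at hx'
  rw [Finset.mem_image]
  rcases hx' with rfl | ⟨k, rfl⟩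
  · exact ⟨P.origin, Finset.mem_univ _, toReal_zero⟩
  · exact ⟨⟨b k, hxc⟩, Finset.mem_univ _, rfl⟩

theorem relationLattice_sum_eq_zero {ℓ : P.Pt → ℤ} (hℓ : ℓ ∈ relationLattice P) (c : ℝ)
    (m : Fin n → ℝ) : ∑ v, (ℓ v : ℝ) * (c + m ⬝ᵥ toReal v.1) = 0 := by
  obtain ⟨h1, h2⟩ := mem_relationLattice_iff.1 hℓ
  have h3 : ∑ v, (ℓ v : ℝ) = 0 := by exact_mod_cast h2
  have h4 : ∀ j, ∑ v : P.Pt, (ℓ v : ℝ) * (v.1 j : ℝ) = 0 := fun j => by exact_mod_cast h1 j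
  simp only [mul_add, Finset.sum_add_distrib, ← Finset.sum_mul, h3, zero_mul, zero_add, dotProduct,
    Finset.mul_sum]
  rw [Finset.sum_comm]
  refine Finset.sum_eq_zero fun j _ => ?_
  rw [← mul_zero (m j), ← h4 j, Finset.mul_sum]
  exact Finset.sum_congr rfl fun v _ => by simp only [toReal]; ring

/-- A relation does not see affine functions. Subtracting the one interpolating `ω` on `s` leaves
weights that vanish on `s` and are nonnegative elsewhere. -/
theorem mem_moriPoints_of_facet {s : Finset (Fin n → ℝ)} (hs : s ∈ T.facets) {ℓ : P.Pt → ℤ}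
    (hℓ : ℓ ∈ relationLattice P) (hpos : ∀ v : P.Pt, toReal v.1 ∉ s → 0 ≤ ℓ v) :
    ℓ ∈ moriPoints P T := by
  refine ⟨hℓ, fun ω hω => ?_⟩
  obtain ⟨c, m, h⟩ := hω s hs
  have h1 : ∑ v, (ℓ v : ℝ) * ω v =
      ∑ v, (ℓ v : ℝ) * (ω v - (c + m ⬝ᵥ toReal v.1)) := by
    simp only [mul_sub, Finset.sum_sub_distrib, relationLattice_sum_eq_zero hℓ, sub_zero]
  rw [h1]
  refine Finset.sum_nonneg fun v _ => ?_
  by_cases hv : toReal v.1 ∈ s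
  · rw [(h v).2.2 hv, sub_self, mul_zero]
  · exact mul_nonneg (by exact_mod_cast hpos v hv) (sub_nonneg.2 (h v).1)

include hT in
-- The values outside `s` may be prescribed: the lattice basis formed by the nonzero vertices solves
-- the linear equations over `ℤ`, and the origin absorbs the total sum.
theorem exists_relation_eq_one {s : Finset (Fin n → ℝ)} (hs : s ∈ T.facets) :
    ∃ κ ∈ relationLattice P, ∀ v : P.Pt, toReal v.1 ∉ s → κ v = 1 := by
  classical
  obtain ⟨b, p, hp, hmem⟩ := exists_basis_of_facet hT hs
  set O : Finset P.Pt := Finset.univ.filter fun v => toReal v.1 ∉ s with hO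
  set y : Fin n → ℤ := ∑ v ∈ O, v.1 with hy
  set κ : P.Pt → ℤ := ∑ v ∈ O, Pi.single v 1 - ∑ k, Pi.single (p k) (b.repr y k) -
    Pi.single P.origin ((O.card : ℤ) - ∑ k, b.repr y k) with hκ
  have hκs : ∀ v, κ v = ∑ w ∈ O, (Pi.single w 1 : P.Pt → ℤ) v -
      ∑ k, (Pi.single (p k) (b.repr y k) : P.Pt → ℤ) v -
      (Pi.single P.origin ((O.card : ℤ) - ∑ k, b.repr y k) : P.Pt → ℤ) v := fun v => by
    rw [hκ, Pi.sub_apply, Pi.sub_apply, Finset.sum_apply, Finset.sum_apply]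
  have hsum : ∀ g : P.Pt → ℤ, ∑ v, κ v * g v = ∑ v ∈ O, g v - ∑ k, b.repr y k * g (p k) -
      ((O.card : ℤ) - ∑ k, b.repr y k) * g P.origin := fun g => by
    simp only [hκs, sub_mul, Finset.sum_sub_distrib, Finset.sum_mul]
    rw [Finset.sum_comm, Finset.sum_comm (s := Finset.univ) (t := (Finset.univ : Finset (Fin n)))]
    simp only [Pi.single_apply, ite_mul, one_mul, zero_mul, Finset.sum_ite_eq', Finset.mem_univ,
      if_true, sub_mul, Finset.sum_mul]
  refine ⟨κ, mem_relationLattice_iff.2 ⟨fun j => ?_, ?_⟩, fun v hv => ?_⟩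
  · rw [hsum fun v => v.1 j]
    have h1 : (∑ k, b.repr y k • b k) j = y j := by rw [b.sum_repr]
    rw [Finset.sum_apply] at h1
    simp only [Pi.smul_apply, smul_eq_mul] at h1
    have h2 : y j = ∑ v ∈ O, v.1 j := by rw [hy, Finset.sum_apply]
    simp only [hp, h1, h2]
    simp [ReflexivePolytope.origin]
  · have := hsum fun _ => 1
    simpa using this
  · have h0 : v ≠ P.origin := fun h => hv ((hmem v).2 (Or.inl h))
    have hk : ∀ k, v ≠ p k := fun k h => hv ((hmem v).2 (Or.inr ⟨k, h⟩))
    rw [hκs, Pi.single_eq_of_ne h0, Finset.sum_eq_zero fun k _ => Pi.single_eq_of_ne (hk k) _,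
      Finset.sum_eq_single v]
    · simp
    · intro w _ hw
      exact Pi.single_eq_of_ne hw.symm _
    · intro h
      exact absurd (by simpa [hO] using hv) h

include hT in
/-- A family of translated simplicial cones of relations has bounded below coordinates. -/
theorem exists_le_repr {r : ℕ} (l : Module.Basis (Fin r) ℤ (relationLattice P))
    (hl : ∀ ℓ : relationLattice P, ℓ.1 ∈ moriPoints P T → ∀ j, 0 ≤ l.repr ℓ j) (N : ℕ) :
    ∃ K : ℕ, ∀ s ∈ T.facets, ∀ ℓ : relationLattice P,
      (∀ v : P.Pt, toReal v.1 ∉ s → -(N : ℤ) ≤ ℓ.1 v) → ∀ j, -(K : ℤ) ≤ l.repr ℓ j := by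
  have h : ∀ s ∈ T.facets, ∃ K : ℕ, ∀ ℓ : relationLattice P,
      (∀ v : P.Pt, toReal v.1 ∉ s → -(N : ℤ) ≤ ℓ.1 v) → ∀ j, -(K : ℤ) ≤ l.repr ℓ j := by
    intro s hs
    obtain ⟨κ, hκ, hκ1⟩ := exists_relation_eq_one hT hs
    refine ⟨∑ j, N * (l.repr ⟨κ, hκ⟩ j).natAbs, fun ℓ hℓ j => ?_⟩
    -- Adding `N κ` makes all entries off `s` nonnegative, so the translate lies in `M` and has
    -- nonnegative coordinates.
    have h1 := hl (ℓ + (N : ℤ) • ⟨κ, hκ⟩) (mem_moriPoints_of_facet hs (Submodule.coe_mem _)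
      fun v hv => by
        have := hℓ v hv
        change 0 ≤ ℓ.1 v + (N : ℤ) * κ v
        rw [hκ1 v hv]
        omega) j
    rw [map_add, map_smul, Finsupp.add_apply, Finsupp.smul_apply, smul_eq_mul] at h1
    have h2 : N * (l.repr ⟨κ, hκ⟩ j).natAbs ≤ ∑ j, N * (l.repr ⟨κ, hκ⟩ j).natAbs :=
      Finset.single_le_sum (f := fun j => N * (l.repr ⟨κ, hκ⟩ j).natAbs)
        (fun _ _ => Nat.zero_le _) (Finset.mem_univ j)
    have h3 : (N : ℤ) * l.repr ⟨κ, hκ⟩ j ≤ N * (l.repr ⟨κ, hκ⟩ j).natAbs :=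
      mul_le_mul_of_nonneg_left Int.le_natAbs (Nat.cast_nonneg N)
    have h4 := (Nat.cast_le (α := ℤ)).2 h2
    rw [Nat.cast_mul] at h4
    linarith
  choose! K hK using h
  refine ⟨∑ s ∈ (finite_facets hT).toFinset, K s, fun s hs ℓ hℓ j => ?_⟩
  have h1 := hK s hs ℓ hℓ j
  have h2 : K s ≤ ∑ s ∈ (finite_facets hT).toFinset, K s :=
    Finset.single_le_sum (fun _ _ => Nat.zero_le _) ((finite_facets hT).mem_toFinset.2 hs)
  omega

end Geometry

/-! ### Nilpotency, finiteness and vanishing in the cohomology ring -/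

section CohomologyRing

variable {n : ℕ} {P : ReflexivePolytope n} {T : Geometry.SimplicialComplex ℝ (Fin n → ℝ)}

theorem sum_divisorClass : ∑ v, divisorClass P T v = 0 := by
  have h : Ideal.Quotient.mk (cohomologyIdeal P T) (∑ v : P.Pt, MvPolynomial.X v) = 0 :=
    Ideal.Quotient.eq_zero_iff_mem.2 (Ideal.subset_span (Or.inl (Or.inl rfl)))
  rw [map_sum] at h
  exact h

theorem sum_smul_divisorClass (j : Fin n) :
    ∑ v : P.Pt, (v.1 j : ℂ) • divisorClass P T v = 0 := by
  have h : Ideal.Quotient.mk (cohomologyIdeal P T)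
      (∑ v : P.Pt, MvPolynomial.C (v.1 j : ℂ) * MvPolynomial.X v) = 0 :=
    Ideal.Quotient.eq_zero_iff_mem.2 (Ideal.subset_span (Or.inl (Or.inr ⟨j, rfl⟩)))
  rw [map_sum] at h
  refine (Finset.sum_congr rfl fun v _ => ?_).trans h
  rw [map_mul, Algebra.smul_def]
  rfl

open Classical in
theorem prod_divisorClass_eq_zero {S : Finset P.Pt} (hS : S.Nonempty) (h0 : P.origin ∉ S)
    (hT : S.image (fun v => toReal v.1) ∉ T.faces) : ∏ v ∈ S, divisorClass P T v = 0 := by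
  have h : Ideal.Quotient.mk (cohomologyIdeal P T) (∏ v ∈ S, MvPolynomial.X v) = 0 :=
    Ideal.Quotient.eq_zero_iff_mem.2 (Ideal.subset_span (Or.inr ⟨S, hS, h0, hT, rfl⟩))
  rw [map_prod] at h
  exact h

variable (hT : IsRegularProjective P T)

include hT in
theorem exists_facet_of_prod_ne_zero {S : Finset P.Pt} (h0 : P.origin ∉ S)
    (h : ∏ v ∈ S, divisorClass P T v ≠ 0) : ∃ s ∈ T.facets, ∀ v ∈ S, toReal v.1 ∈ s := by
  classical
  rcases S.eq_empty_or_nonempty with rfl | hS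
  · obtain ⟨s, hs⟩ := exists_facet hT
    exact ⟨s, hs, by simp⟩
  · by_cases hf : S.image (fun v => toReal v.1) ∈ T.faces
    · obtain ⟨s, hs, hsub⟩ := exists_facet_superset hf
      exact ⟨s, hs, fun v hv => hsub (Finset.mem_image_of_mem _ hv)⟩
    · exact absurd (prod_divisorClass_eq_zero hS h0 hf) h

theorem linearMap_eq_dotProduct (m : (Fin n → ℤ) →ₗ[ℤ] ℤ) (v : Fin n → ℤ) :
    m v = v ⬝ᵥ fun j => m (Pi.single j 1) := by
  conv_lhs => rw [← Finset.univ_sum_single v]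
  rw [map_sum]
  refine Finset.sum_congr rfl fun j _ => ?_
  rw [← smul_eq_mul, ← map_smul, ← Pi.single_smul, smul_eq_mul, mul_one]

theorem sum_linear_mul_divisorClass (m : (Fin n → ℤ) →ₗ[ℤ] ℤ) :
    ∑ v : P.Pt, (m v.1 : ℂ) • divisorClass P T v = 0 := by
  have h2 : ∀ v : P.Pt, (m v.1 : ℂ) • divisorClass P T v =
      ∑ j, ((v.1 j * m (Pi.single j 1) : ℤ) : ℂ) • divisorClass P T v := fun v => by
    rw [linearMap_eq_dotProduct m v.1, dotProduct, Int.cast_sum, Finset.sum_smul]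
  rw [Finset.sum_congr rfl fun v _ => h2 v, Finset.sum_comm]
  refine Finset.sum_eq_zero fun j _ => ?_
  rw [← smul_zero (m (Pi.single j 1) : ℂ), ← sum_smul_divisorClass (P := P) (T := T) j,
    Finset.smul_sum]
  refine Finset.sum_congr rfl fun v _ => ?_
  rw [smul_smul, mul_comm, Int.cast_mul]

include hT in
-- Membership in every prime `J` is checked. The nonzero points whose classes avoid `J` have product
-- outside `J`, so they lie on one simplex. If `p k` is one of them, the linear relation given by
-- the `k`-th dual coordinate of its basis kills the other such points and expresses the class of `p
-- k` through classes in `J`, a contradiction.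
theorem isNilpotent_divisorClass (v : P.Pt) : IsNilpotent (divisorClass P T v) := by
  classical
  rw [nilpotent_iff_mem_prime]
  intro J hJ
  have key : ∀ w : P.Pt, w ≠ P.origin → divisorClass P T w ∈ J := by
    set S : Finset P.Pt :=
      Finset.univ.filter fun w => w ≠ P.origin ∧ divisorClass P T w ∉ J with hS
    have hprod : ∏ w ∈ S, divisorClass P T w ∉ J := fun h => by
      obtain ⟨w, hw, hwJ⟩ := hJ.prod_mem_iff.1 h
      exact (Finset.mem_filter.1 hw).2.2 hwJ
    obtain ⟨s, hs, hSs⟩ := exists_facet_of_prod_ne_zero hT (S := S) (by simp [hS])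
      fun h => hprod (h ▸ J.zero_mem)
    obtain ⟨b, p, hp, hmem⟩ := exists_basis_of_facet hT hs
    intro w hw
    by_contra hwJ
    have hwS : w ∈ S := by simp [hS, hw, hwJ]
    obtain ⟨k, rfl⟩ := ((hmem w).1 (hSs w hwS)).resolve_left hw
    have h1 := sum_linear_mul_divisorClass (P := P) (T := T) (b.coord k)
    rw [← Finset.add_sum_erase _ _ (Finset.mem_univ (p k)), hp] at h1
    have h2 : ∑ v ∈ Finset.univ.erase (p k),
        ((b.coord k v.1 : ℤ) : ℂ) • divisorClass P T v ∈ J := by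
      refine J.sum_mem fun x hx => ?_
      rw [Algebra.smul_def]
      by_cases hxS : x ∈ S
      · obtain ⟨k', rfl⟩ := ((hmem x).1 (hSs x hxS)).resolve_left (Finset.mem_filter.1 hxS).2.1
        have hne : k' ≠ k := fun h => (Finset.ne_of_mem_erase hx) (by rw [h])
        rw [hp, Module.Basis.coord_apply, b.repr_self, Finsupp.single_eq_of_ne hne.symm]
        simp
      · by_cases hx0 : x = P.origin
        · subst hx0
          rw [show P.origin.1 = 0 from rfl, map_zero]
          simp
        · refine J.mul_mem_left _ ?_
          by_contra hxJ
          exact hxS (by simp [hS, hx0, hxJ])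
    rw [Module.Basis.coord_apply, b.repr_self, Finsupp.single_eq_same, Int.cast_one,
      one_smul] at h1
    rw [eq_neg_of_add_eq_zero_left h1] at hwJ
    exact hwJ (J.neg_mem h2)
  by_cases hv : v = P.origin
  · subst hv
    have h := sum_divisorClass (P := P) (T := T)
    rw [← Finset.add_sum_erase _ _ (Finset.mem_univ P.origin)] at h
    rw [eq_neg_of_add_eq_zero_left h]
    exact J.neg_mem (J.sum_mem fun w hw => key w (Finset.ne_of_mem_erase hw))
  · exact key v hv

include hT in
-- The algebra is generated by finitely many nilpotent, hence integral, elements.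
theorem finite_cohomology : Module.Finite ℂ (Cohomology P T) := by
  have hadj : Algebra.adjoin ℂ (Set.range (divisorClass P T)) = ⊤ := by
    have h1 : (Ideal.Quotient.mkₐ ℂ (cohomologyIdeal P T)).range = ⊤ :=
      AlgHom.range_eq_top _ |>.2 (Ideal.Quotient.mkₐ_surjective _ _)
    have h2 := MvPolynomial.adjoin_range_X (σ := P.Pt) (R := ℂ)
    have h3 := congrArg (Subalgebra.map (Ideal.Quotient.mkₐ ℂ (cohomologyIdeal P T))) h2
    rw [AlgHom.map_adjoin, Algebra.map_top, h1, ← Set.range_comp] at h3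
    exact h3
  have hfin := Algebra.finite_adjoin_of_finite_of_isIntegral (R := ℂ)
    (s := Set.range (divisorClass P T)) (Set.finite_range _) (by
      rintro _ ⟨v, rfl⟩
      obtain ⟨N, hN⟩ := isNilpotent_divisorClass hT v
      exact IsIntegral.of_pow (n := N + 1) (Nat.succ_pos _) (by
        rw [pow_succ, hN, zero_mul]
        exact isIntegral_zero))
  rw [hadj] at hfin
  exact Module.Finite.equiv (Subalgebra.topEquiv (R := ℂ) (A := Cohomology P T)).toLinearEquiv

include hT in
-- The product of the `D_v` over nonzero `v` with `m_v < 0` divides the coefficient, so these `v`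
-- lie on one simplex. The sign at the origin is unconstrained, since the origin belongs to every
-- maximal simplex.
theorem exists_facet_of_gammaCoeff_ne_zero {m : P.Pt → ℤ}
    (h : gammaCoeff (divisorClass P T) m ≠ 0) :
    ∃ s ∈ T.facets, ∀ v : P.Pt, toReal v.1 ∉ s → 0 ≤ m v := by
  classical
  have h1 := prod_dvd_gammaCoeff (divisorClass P T) (m := m)
    (S := Finset.univ.filter fun v => v ≠ P.origin ∧ m v < 0)
    fun v hv => (Finset.mem_filter.1 hv).2.2
  obtain ⟨s, hs, hsS⟩ := exists_facet_of_prod_ne_zero hT (by simp)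
    fun h0 => h (zero_dvd_iff.1 (h0 ▸ h1))
  refine ⟨s, hs, fun v hv => ?_⟩
  by_contra hneg
  obtain ⟨b, p, -, hmem⟩ := exists_basis_of_facet hT hs
  refine hv (hsS v ?_)
  simp only [Finset.mem_filter, Finset.mem_univ, true_and]
  exact ⟨fun h0 => hv ((hmem v).2 (Or.inl h0)), not_le.1 hneg⟩

end CohomologyRing

/-! ### Comparison of `O_ℓ` with the Gamma coefficients -/

section ONormed

variable {n : ℕ} {P : ReflexivePolytope n} {T : Geometry.SimplicialComplex ℝ (Fin n → ℝ)}

theorem oCoeff_eq (ℓ : P.Pt → ℤ) :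
    oCoeff P T ℓ = (∏ v ∈ Finset.univ.erase P.origin, gammaQuot (divisorClass P T v) (ℓ v)) *
      ∏ k ∈ Finset.range (-ℓ P.origin).toNat,
        (divisorClass P T P.origin - ((k + 1 : ℕ) : Cohomology P T)) := by
  have h1 : ∀ (p : P.Pt → Prop) [DecidablePred p] (f : P.Pt → Cohomology P T),
      (∀ v, ¬ p v → f v = 1) →
      ∏ v : P.Pt with v ≠ P.origin ∧ p v, f v = ∏ v ∈ Finset.univ.erase P.origin, f v := by
    intro p _ f hf
    refine Finset.prod_subset (fun v hv => ?_) fun v hv hv' => hf v fun h => hv' ?_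
    · simpa using (Finset.mem_filter.1 hv).2.1
    · simp [Finset.ne_of_mem_erase hv, h]
  unfold oCoeff gammaQuot
  rw [Finset.prod_mul_distrib, ← inverse_prod, h1 (fun v => ℓ v < 0), h1 (fun v => 0 ≤ ℓ v)]
  · intro v hv
    rw [Int.toNat_of_nonpos (by omega), Finset.range_zero, Finset.prod_empty]
  · intro v hv
    rw [Int.toNat_of_nonpos (by omega), Finset.range_zero, Finset.prod_empty]

theorem exists_facet_of_oCoeff_ne_zero (hT : IsRegularProjective P T) {ℓ : P.Pt → ℤ}
    (h : oCoeff P T ℓ ≠ 0) : ∃ s ∈ T.facets, ∀ v : P.Pt, toReal v.1 ∉ s → 0 ≤ ℓ v := by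
  classical
  set S : Finset P.Pt := Finset.univ.filter fun v => v ≠ P.origin ∧ ℓ v < 0 with hS
  have h1 : ∏ v ∈ S, divisorClass P T v ∣ oCoeff P T ℓ := by
    rw [oCoeff_eq]
    refine Dvd.dvd.mul_right ?_ _
    refine (Finset.prod_dvd_prod_of_dvd _ _ fun v hv =>
      dvd_gammaQuot (Finset.mem_filter.1 hv).2.2).trans (Finset.prod_dvd_prod_of_subset _ _ _ ?_)
    intro v hv
    simp [(Finset.mem_filter.1 hv).2.1]
  obtain ⟨s, hs, hsS⟩ := exists_facet_of_prod_ne_zero hT (S := S) (by simp [hS])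
    fun h0 => h (zero_dvd_iff.1 (h0 ▸ h1))
  refine ⟨s, hs, fun v hv => ?_⟩
  by_contra hneg
  obtain ⟨b, p, -, hmem⟩ := exists_basis_of_facet hT hs
  refine hv (hsS v ?_)
  simp only [hS, Finset.mem_filter, Finset.mem_univ, true_and]
  exact ⟨fun h0 => hv ((hmem v).2 (Or.inl h0)), not_le.1 hneg⟩

/-- The product at the origin in `O_ℓ` starts at `D_0 - 1`. The extra `D_0` completes it to the
Gamma quotient with exponent `ℓ_0 - 1`. For `ℓ_0 > 0` the formulas would disagree, but `hsign` makes
both sides zero. -/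
theorem oCoeff_mul_divisorClass_origin (hT : IsRegularProjective P T)
    (hsign : ∀ ℓ ∈ relationLattice P, (∃ s ∈ T.facets, ∀ v : P.Pt, toReal v.1 ∉ s → 0 ≤ ℓ v) →
      ℓ P.origin ≤ 0) {ℓ : P.Pt → ℤ} (hℓ : ℓ ∈ relationLattice P) :
    oCoeff P T ℓ * divisorClass P T P.origin =
      gammaCoeff (divisorClass P T) (-Pi.single P.origin 1 + ℓ) := by
  have hne : ∀ v, v ≠ P.origin → (-Pi.single P.origin 1 + ℓ : P.Pt → ℤ) v = ℓ v := fun v hv => by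
    simp [Pi.single_eq_of_ne hv]
  by_cases h0 : ℓ P.origin ≤ 0
  · rw [oCoeff_eq, gammaCoeff, ← Finset.mul_prod_erase _ _ (Finset.mem_univ P.origin),
      mul_comm (gammaQuot _ _), mul_assoc]
    congr 1
    · exact Finset.prod_congr rfl fun v hv => by rw [hne v (Finset.ne_of_mem_erase hv)]
    · have h1 : (-Pi.single P.origin 1 + ℓ : P.Pt → ℤ) P.origin = ℓ P.origin - 1 := by
        simp; ring
      rw [h1, gammaQuot_of_neg (by omega),
        show (-(ℓ P.origin - 1)).toNat = (-ℓ P.origin).toNat + 1 by omega, Finset.prod_range_succ']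
      simp
  · have h1 : oCoeff P T ℓ = 0 := by
      by_contra h
      exact h0 (hsign ℓ hℓ (exists_facet_of_oCoeff_ne_zero hT h))
    rw [h1, zero_mul, eq_comm]
    by_contra h
    obtain ⟨s, hs, hpos⟩ := exists_facet_of_gammaCoeff_ne_zero hT h
    refine h0 (hsign ℓ hℓ ⟨s, hs, fun v hv => ?_⟩)
    obtain ⟨b, p, -, hmem⟩ := exists_basis_of_facet hT hs
    rw [← hne v fun h => hv ((hmem v).2 (Or.inl h))]
    exact hpos v hv

/-- This allows the sum over `M` to be replaced by the sum over all of `L`, which is what reindexing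
requires. -/
theorem gammaCoeff_eq_zero_of_notMem (hT : IsRegularProjective P T) {ℓ : P.Pt → ℤ}
    (hℓ : ℓ ∈ relationLattice P) (h : ℓ ∉ moriPoints P T) :
    gammaCoeff (divisorClass P T) (-Pi.single P.origin 1 + ℓ) = 0 := by
  by_contra h0
  obtain ⟨s, hs, hpos⟩ := exists_facet_of_gammaCoeff_ne_zero hT h0
  refine h (mem_moriPoints_of_facet hs hℓ fun v hv => ?_)
  obtain ⟨b, p, -, hmem⟩ := exists_basis_of_facet hT hs
  have h1 := hpos v hv
  rwa [Pi.add_apply, Pi.neg_apply, Pi.single_eq_of_ne fun h => hv ((hmem v).2 (Or.inl h)), neg_zero,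
    zero_add] at h1

end ONormed

/-! ### Passage to a Banach algebra -/

section Transfer

theorem map_ringInverse_equiv {A B : Type*} [CommRing A] [CommRing B] (φ : A ≃+* B) (x : A) :
    φ (Ring.inverse x) = Ring.inverse (φ x) := by
  by_cases hx : IsUnit x
  · have h1 : IsUnit (φ x) := hx.map φ
    rw [← mul_one (φ (Ring.inverse x)), ← Ring.mul_inverse_cancel _ h1, ← mul_assoc, ← map_mul,
      Ring.inverse_mul_cancel _ hx, map_one, one_mul]
  · have h1 : ¬ IsUnit (φ x) := fun h => hx (by simpa using h.map φ.symm)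
    rw [Ring.inverse_non_unit _ hx, Ring.inverse_non_unit _ h1, map_zero]

theorem map_gammaQuot {A B : Type*} [CommRing A] [CommRing B] (φ : A ≃+* B) (D : A) (m : ℤ) :
    φ (gammaQuot D m) = gammaQuot (φ D) m := by
  unfold gammaQuot
  simp only [map_mul, map_prod, map_ringInverse_equiv, map_sub, map_add, map_natCast]

theorem map_gammaCoeff {A B : Type*} [CommRing A] [CommRing B] (φ : A ≃+* B) {ι : Type*}
    [Fintype ι] (D : ι → A) (m : ι → ℤ) :
    φ (gammaCoeff D m) = gammaCoeff (fun v => φ (D v)) m := by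
  unfold gammaCoeff
  simp only [map_prod, map_gammaQuot]

theorem map_nilpotentExp {A B : Type*} [CommRing A] [Algebra ℚ A] [NormedCommRing B]
    [NormedAlgebra ℂ B] (φ : A →+* B) {x : A} (hx : IsNilpotent x) :
    φ (IsNilpotent.exp x) = NormedSpace.exp (φ x) := by
  obtain ⟨N, hN⟩ := hx
  rw [IsNilpotent.exp_eq_sum hN, map_sum, NormedSpace.exp_eq_tsum ℂ]
  dsimp only
  rw [tsum_eq_sum (s := Finset.range N)]
  · refine Finset.sum_congr rfl fun k _ => ?_
    have h : ((k.factorial : ℕ) : ℂ) ≠ 0 := Nat.cast_ne_zero.2 (Nat.factorial_ne_zero k)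
    have h1 : ((k.factorial : ℕ) : ℂ) • φ ((k.factorial : ℚ)⁻¹ • x ^ k) = φ x ^ k := by
      rw [Algebra.smul_def, map_natCast, ← map_natCast φ, ← map_mul, ← nsmul_eq_mul,
        ← Nat.cast_smul_eq_nsmul ℚ, smul_smul, mul_inv_cancel₀
          (Nat.cast_ne_zero.2 (Nat.factorial_ne_zero k)), one_smul, map_pow]
    rw [← h1, smul_smul, inv_mul_cancel₀ h, one_smul]
  · intro k hk
    have : N ≤ k := by simpa using hk
    rw [← map_pow, pow_eq_zero_of_le this hN, map_zero, smul_zero]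

/-- A finite-dimensional commutative algebra is a Banach algebra. -/
theorem exists_normedAlgebra (H : Type) [CommRing H] [Algebra ℂ H] [Module.Finite ℂ H] :
    ∃ (R : Type) (_ : NormedCommRing R) (_ : NormedAlgebra ℂ R), Nonempty (H ≃ₐ[ℂ] R) := by
  classical
  let : NormedRing (Matrix (Fin (Module.finrank ℂ H)) (Fin (Module.finrank ℂ H)) ℂ) :=
    Matrix.linftyOpNormedRing
  let : NormedAlgebra ℂ (Matrix (Fin (Module.finrank ℂ H)) (Fin (Module.finrank ℂ H)) ℂ) :=
    Matrix.linftyOpNormedAlgebra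
  -- The regular representation embeds the algebra into matrices, whose operator norm is
  -- submultiplicative.
  let f := Algebra.leftMulMatrix (Module.finBasis ℂ H)
  have hf : Function.Injective f := Algebra.leftMulMatrix_injective _
  let i1 : NormedCommRing H := NormedCommRing.induced H _ f hf
  let i2 : NormedAlgebra ℂ H := NormedAlgebra.induced ℂ H _ f
  exact ⟨H, i1, i2, ⟨AlgEquiv.refl⟩⟩

end Transfer

/-! ### Domination of the series and the solution property -/

section Convergence

variable {n : ℕ} {P : ReflexivePolytope n} {T : Geometry.SimplicialComplex ℝ (Fin n → ℝ)}

instance isModuleTopology_cohomology : IsModuleTopology ℂ (Cohomology P T) := ⟨rfl⟩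

theorem IsDominated.mono {r : ℕ} {l : Module.Basis (Fin r) ℤ (relationLattice P)} {E : Type*}
    [NormedAddCommGroup E] {b : relationLattice P → E} {Q Q' : ℝ} (hQ : 1 ≤ Q) (hQQ' : Q ≤ Q')
    (h : IsDominated l Q b) : IsDominated l Q' b where
  growth := by
    obtain ⟨C, hC⟩ := h.growth
    have hC0 : 0 ≤ C := by simpa using (norm_nonneg _).trans (hC 0)
    refine ⟨C, fun ℓ => (hC ℓ).trans ?_⟩
    gcongr
  support := h.support

theorem sum_relation_eq_zero (ℓ : relationLattice P) : ∑ v, ℓ.1 v = 0 :=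
  (mem_relationLattice_iff.1 ℓ.2).2

section Domination

variable (hT : IsRegularProjective P T) {r : ℕ} (l : Module.Basis (Fin r) ℤ (relationLattice P))
  (hl : ∀ ℓ : relationLattice P, ℓ.1 ∈ moriPoints P T → ∀ j, 0 ≤ l.repr ℓ j)
  {R : Type*} [NormedCommRing R] [NormedAlgebra ℂ R] (φ : Cohomology P T ≃ₐ[ℂ] R)

include hT hl in
theorem exists_isDominated_gammaCoeff : ∃ Q : ℝ, 1 ≤ Q ∧ ∀ γ : P.Pt → ℤ,
    IsDominated l Q fun ℓ : relationLattice P =>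
      gammaCoeff (fun v => φ (divisorClass P T v)) (γ + ℓ.1) := by
  obtain ⟨Q, hQ, h⟩ := exists_norm_prod_le
    (g := fun v m => gammaQuot (φ (divisorClass P T v)) m)
    fun v => exists_norm_gammaQuot_le ((isNilpotent_divisorClass hT v).map φ)
  refine ⟨Q, hQ, fun γ => ⟨?_, ?_⟩⟩
  · obtain ⟨C, hC, h⟩ := h (∑ v, γ v)
    refine ⟨C * Q ^ ∑ v, (γ v).natAbs, fun ℓ => (h (γ + ℓ.1) ?_).trans ?_⟩
    · simp only [Pi.add_apply, Finset.sum_add_distrib, sum_relation_eq_zero, add_zero]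
    · rw [mul_assoc, ← pow_add, ← Finset.sum_add_distrib]
      gcongr with v
      exact Int.natAbs_add_le _ _
  · obtain ⟨K, hK⟩ := exists_le_repr hT l hl (∑ v, (γ v).natAbs)
    refine ⟨K, fun ℓ hℓ => ?_⟩
    have h1 : gammaCoeff (divisorClass P T) (γ + ℓ.1) ≠ 0 := fun h0 => hℓ (by
      have := map_gammaCoeff φ.toRingEquiv (divisorClass P T) (γ + ℓ.1)
      rw [h0, map_zero] at this
      exact this.symm)
    obtain ⟨s, hs, hpos⟩ := exists_facet_of_gammaCoeff_ne_zero hT h1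
    refine hK s hs ℓ fun v hv => ?_
    have h2 := hpos v hv
    have h3 : (γ v).natAbs ≤ ∑ v, (γ v).natAbs :=
      Finset.single_le_sum (f := fun v => (γ v).natAbs) (fun _ _ => Nat.zero_le _)
        (Finset.mem_univ v)
    rw [Pi.add_apply] at h2
    omega

open Classical in
include hT hl in
-- The series of the `O_ℓ` must converge before multiplication by `D_0`, so it needs an estimate of
-- its own.
theorem exists_isDominated_oCoeff
    (hsign : ∀ ℓ ∈ relationLattice P, (∃ s ∈ T.facets, ∀ v : P.Pt, toReal v.1 ∉ s → 0 ≤ ℓ v) →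
      ℓ P.origin ≤ 0) : ∃ Q : ℝ, 1 ≤ Q ∧
    IsDominated l Q fun ℓ : relationLattice P =>
      if ℓ.1 ∈ moriPoints P T then φ (oCoeff P T ℓ.1) else 0 := by
  set D : P.Pt → R := fun v => φ (divisorClass P T v) with hD
  -- Positive exponents at the origin get the value `0`, which satisfies the required bound. By
  -- `hsign` the class `O_ℓ` vanishes for them anyway.
  set g : P.Pt → ℤ → R := fun v m => if v = P.origin then
    (if m ≤ 0 then ∏ k ∈ Finset.range (-m).toNat, (D P.origin - ((k + 1 : ℕ) : R)) else 0)
    else gammaQuot (D v) m with hg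
  have hgb : ∀ v, ∃ C Q : ℝ, 0 ≤ C ∧ 1 ≤ Q ∧
      ∀ m : ℤ, ‖g v m‖ ≤ C * (Q ^ m.natAbs * gammaWeight m) := by
    intro v
    by_cases hv : v = P.origin
    · refine ⟨‖(1 : R)‖, ‖D P.origin‖ + ‖(1 : R)‖ + 1, norm_nonneg _,
        le_add_of_nonneg_left (by positivity), fun m => ?_⟩
      have hw := gammaWeight_nonneg m
      by_cases hm : m ≤ 0
      · have h := norm_prod_range_le (D P.origin) 1 (-m).toNat le_rfl
        simp only [hg, if_pos hv, if_pos hm]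
        rw [gammaWeight, Int.toNat_of_nonpos hm, Nat.factorial_zero, Nat.cast_one, div_one,
          show m.natAbs = (-m).toNat by omega]
        exact h
      · simp only [hg, if_pos hv, if_neg hm, norm_zero]
        positivity
    · obtain ⟨C, Q, hC, hQ, h⟩ :=
        exists_norm_gammaQuot_le ((isNilpotent_divisorClass hT v).map φ)
      exact ⟨C, Q, hC, hQ, fun m => by simpa only [hg, if_neg hv] using h m⟩
  obtain ⟨Q, hQ, h⟩ := exists_norm_prod_le hgb
  refine ⟨Q, hQ, ?_, 0, fun ℓ hℓ j => ?_⟩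
  · obtain ⟨C, hC, h⟩ := h 0
    refine ⟨C, fun ℓ => ?_⟩
    have h1 : φ (oCoeff P T ℓ.1) = ∏ v, g v (ℓ.1 v) ∨ φ (oCoeff P T ℓ.1) = 0 := by
      by_cases h0 : ℓ.1 P.origin ≤ 0
      · left
        rw [oCoeff_eq, ← Finset.mul_prod_erase _ _ (Finset.mem_univ P.origin), map_mul, mul_comm]
        congr 1
        · simp only [hg, if_pos h0, if_true, map_prod, map_sub, map_natCast, hD]
        · rw [map_prod]
          refine Finset.prod_congr rfl fun v hv => ?_
          simp only [hg, if_neg (Finset.ne_of_mem_erase hv)]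
          exact map_gammaQuot φ.toRingEquiv _ _
      · right
        rw [map_eq_zero_iff φ φ.injective]
        by_contra hne
        exact h0 (hsign _ ℓ.2 (exists_facet_of_oCoeff_ne_zero hT hne))
    have h2 := h ℓ.1 (sum_relation_eq_zero ℓ)
    have h3 : 0 ≤ C * Q ^ ∑ v, (ℓ.1 v).natAbs := by positivity
    split_ifs
    · rcases h1 with h1 | h1
      · rwa [h1]
      · rwa [h1, norm_zero]
    · rwa [norm_zero]
  · by_cases hm : ℓ.1 ∈ moriPoints P T
    · simpa using hl ℓ hm j
    · simp [hm] at hℓ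

end Domination

/-- Convergence of the series, and the equations for its coefficient functions. -/
theorem exists_radius (hT : IsRegularProjective P T)
    (hsign : ∀ ℓ ∈ relationLattice P, (∃ s ∈ T.facets, ∀ v : P.Pt, toReal v.1 ∉ s → 0 ≤ ℓ v) →
      ℓ P.origin ≤ 0) {r : ℕ} (l : Module.Basis (Fin r) ℤ (relationLattice P))
    (hl : ∀ ℓ : relationLattice P, ℓ.1 ∈ moriPoints P T → ∀ j, 0 ≤ l.repr ℓ j) :
    ∃ ε : ℝ, 0 < ε ∧
      (∀ a ∈ lcslNhd P l ε, Summable fun ℓ : moriPoints P T =>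
        laurent ℓ.1 a • oCoeff P T ℓ.1) ∧
      ∀ U : Set (P.Pt → ℂ), IsOpen U → U ⊆ lcslNhd P l ε →
        ∀ lg : (P.Pt → ℂ) → P.Pt → ℂ, IsLogBranch U lg → ∀ α : Cohomology P T →ₗ[ℂ] ℂ,
          ∀ f : (P.Pt → ℂ) → ℂ,
            (f = fun a => α (bFunction P T lg a * -divisorClass P T P.origin)) →
            IsGKZSolution P U f ∧ ∀ (u : Fin n → ℤ) (v : P.Pt), v.1 ⬝ᵥ u = -1 →
              (∀ v' : P.Pt, v'.1 ⬝ᵥ u ≠ -1 → ∃ w : P.Pt, w.1 = v'.1 + v.1) →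
              ∀ a ∈ U, rootOperator P u v.1 f a = 0 := by
  classical
  have := finite_cohomology hT
  obtain ⟨R, _, _, ⟨φ⟩⟩ := exists_normedAlgebra (Cohomology P T)
  have : Module.Finite ℂ R := Module.Finite.equiv φ.toLinearEquiv
  have : CompleteSpace R := FiniteDimensional.complete ℂ R
  have : ContinuousSMul ℂ (Cohomology P T) := IsModuleTopology.toContinuousSMul ℂ _
  have : IsTopologicalAddGroup (Cohomology P T) := IsModuleTopology.topologicalAddGroup ℂ _
  obtain ⟨Q₁, hQ₁, hd₁⟩ := exists_isDominated_gammaCoeff hT l hl φ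
  obtain ⟨Q₂, hQ₂, hd₂⟩ := exists_isDominated_oCoeff hT l hl φ hsign
  set Q := max Q₁ Q₂ with hQdef
  have hQ : 1 ≤ Q := hQ₁.trans (le_max_left _ _)
  replace hd₁ := fun γ => (hd₁ γ).mono hQ₁ (le_max_left Q₁ Q₂)
  replace hd₂ := hd₂.mono hQ₂ (le_max_right Q₁ Q₂)
  set D : P.Pt → R := fun v => φ (divisorClass P T v) with hDdef
  have hD : ∀ v, IsNilpotent (D v) := fun v => (isNilpotent_divisorClass hT v).map φ
  have hφc : Continuous φ := IsModuleTopology.continuous_of_linearMap φ.toLinearMap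
  have hφsc : Continuous φ.symm :=
    LinearMap.continuous_of_finiteDimensional φ.symm.toLinearMap
  set inc : moriPoints P T → relationLattice P := fun ℓ => ⟨ℓ.1, ℓ.2.1⟩ with hinc
  have hinj : Function.Injective inc := fun x y h => Subtype.ext (congrArg (fun z => z.1) h)
  have hsumR : ∀ a ∈ lcslNhd P l (convRadius l Q), Summable fun ℓ : moriPoints P T =>
      laurent ℓ.1 a • φ (oCoeff P T ℓ.1) := fun a ha => by
    have h := (summable_laurentSeries hQ hd₂ 0 ha).comp_injective hinj
    refine h.congr fun ℓ => ?_
    simp only [Function.comp_apply, hinc, zero_add, if_pos ℓ.2]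
  have hsumH : ∀ a ∈ lcslNhd P l (convRadius l Q), Summable fun ℓ : moriPoints P T =>
      laurent ℓ.1 a • oCoeff P T ℓ.1 := fun a ha => by
    refine ((hsumR a ha).map φ.symm hφsc).congr fun ℓ => ?_
    simp only [Function.comp_apply, map_smul, AlgEquiv.symm_apply_apply]
  refine ⟨convRadius l Q, convRadius_pos l hQ, hsumH, ?_⟩
  rintro U hU hUl lg hlg α f rfl
  -- The sign comes from the factor `-D_0`.
  set ψ : R →L[ℂ] ℂ := -(α ∘ₗ φ.symm.toLinearMap).toContinuousLinearMap with hψ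
  have hf : Set.EqOn (fun a => α (bFunction P T lg a * -divisorClass P T P.origin))
      (fun a => ψ (hyperSeries D lg (-Pi.single P.origin 1) a)) U := by
    intro a ha
    have ha' := hUl ha
    have h1 : φ (bFunction P T lg a * divisorClass P T P.origin) =
        hyperSeries D lg (-Pi.single P.origin 1) a := by
      have h2 : φ (∑' ℓ : moriPoints P T, laurent ℓ.1 a • oCoeff P T ℓ.1) =
          ∑' ℓ : moriPoints P T, laurent ℓ.1 a • φ (oCoeff P T ℓ.1) := by
        refine (((hsumH a ha').hasSum.map φ hφc).tsum_eq.symm).trans (tsum_congr fun ℓ => ?_)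
        simp only [Function.comp_apply, map_smul]
      have h3 : φ (IsNilpotent.exp (∑ v, lg a v • divisorClass P T v)) =
          NormedSpace.exp (∑ v, lg a v • D v) := by
        refine (map_nilpotentExp (φ : Cohomology P T →+* R) ?_).trans ?_
        · exact isNilpotent_sum fun v _ => (isNilpotent_divisorClass hT v).smul _
        · congr 1
          rw [RingHom.coe_coe, map_sum]
          exact Finset.sum_congr rfl fun v _ => map_smul _ _ _
      have h4 : (a P.origin)⁻¹ •
          ((∑' ℓ : moriPoints P T, laurent ℓ.1 a • φ (oCoeff P T ℓ.1)) * D P.origin) =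
          laurentSeries (fun ℓ => gammaCoeff D (-Pi.single P.origin 1 + ℓ.1))
            (-Pi.single P.origin 1) a := by
        rw [← (hsumR a ha').tsum_mul_right, ← tsum_const_smul'', laurentSeries]
        have h5 : ∀ ℓ : P.Pt → ℤ, gammaCoeff D (-Pi.single P.origin 1 + ℓ) =
            φ (gammaCoeff (divisorClass P T) (-Pi.single P.origin 1 + ℓ)) := fun ℓ =>
          (map_gammaCoeff φ.toRingEquiv (divisorClass P T) _).symm
        -- The sum over `L` is restricted to `M`. The side condition is that the terms outside `M`
        -- vanish.
        rw [← hinj.tsum_eq]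
        · refine tsum_congr fun ℓ => ?_
          have h6 : laurent (-Pi.single P.origin 1 + ℓ.1) a = (a P.origin)⁻¹ * laurent ℓ.1 a := by
            rw [← mul_laurent_sub_single ha'.1 ℓ.1 P.origin, ← mul_assoc,
              inv_mul_cancel₀ (ha'.1 _), one_mul, neg_add_eq_sub]
          rw [hinc, h5, ← oCoeff_mul_divisorClass_origin hT hsign ℓ.2.1, h6, map_mul,
            smul_mul_assoc, smul_smul]
        · intro ℓ hℓ
          by_contra hr
          refine hℓ ?_
          dsimp only
          rw [h5, gammaCoeff_eq_zero_of_notMem hT ℓ.2 fun hm => hr ⟨⟨ℓ.1, hm⟩, rfl⟩, map_zero,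
            smul_zero]
      rw [bFunction, hyperSeries, ← h4, ← h3, ← h2, map_mul, map_smul, map_mul, smul_mul_assoc,
        smul_mul_assoc, mul_right_comm]
    dsimp only
    rw [← h1, mul_neg, map_neg]
    simp [hψ]
  have hsum : ∑ v, D v = 0 := by
    rw [hDdef, ← map_sum, sum_divisorClass, map_zero]
  have hlin : ∀ j : Fin n, ∑ v : P.Pt, (v.1 j : ℂ) • D v = 0 := fun j => by
    simp only [hDdef, ← map_smul]
    rw [← map_sum, sum_smul_divisorClass, map_zero]
  exact ⟨isGKZSolution_of_eqOn hD hQ hd₁ hU hUl hlg ψ hsum hlin hf, fun u v hv hadd a ha =>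
    rootOperator_eq_zero_of_eqOn hD hQ hd₁ hU hUl hlg ψ hsum hlin hf hv hadd ha⟩

end Convergence

/-! ### The polytope of projective space, its dual and its roots -/

section ProjectiveSpace

variable {n : ℕ}

theorem dotProduct_simplexNormal_zero (v : Fin n → ℤ) : v ⬝ᵥ simplexNormal 0 = -∑ k, v k := by
  simp [simplexNormal, dotProduct]

theorem dotProduct_simplexNormal_succ (v : Fin n → ℤ) (k : Fin n) :
    v ⬝ᵥ simplexNormal k.succ = v k := by
  simp [simplexNormal]

theorem real_dotProduct_simplexNormal_zero (x : Fin n → ℝ) :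
    x ⬝ᵥ toReal (simplexNormal 0) = -∑ k, x k := by
  simp [simplexNormal, dotProduct, toReal]

theorem real_dotProduct_simplexNormal_succ (x : Fin n → ℝ) (k : Fin n) :
    x ⬝ᵥ toReal (simplexNormal k.succ) = x k := by
  simp [simplexNormal, toReal, dotProduct, Pi.single_apply]

theorem sum_dotProduct_simplexNormal (v : Fin n → ℤ) : ∑ i, v ⬝ᵥ simplexNormal i = 0 := by
  rw [Fin.sum_univ_succ, dotProduct_simplexNormal_zero]
  simp only [dotProduct_simplexNormal_succ]
  ring

theorem ext_simplexNormal {v w : Fin n → ℤ}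
    (h : ∀ i, v ⬝ᵥ simplexNormal i = w ⬝ᵥ simplexNormal i) : v = w := by
  funext k
  simpa only [dotProduct_simplexNormal_succ] using h k.succ

theorem simplexPoint_dotProduct (i k : Fin (n + 1)) :
    (simplexPoint i : Fin n → ℤ) ⬝ᵥ simplexNormal k =
      (if i = k then 1 else 0) - (if k = 0 then 1 else 0) := by
  refine Fin.cases ?_ (fun k => ?_) k
  · rw [dotProduct_simplexNormal_zero]
    refine Fin.cases ?_ (fun i => ?_) i
    · simp [simplexPoint]
    · simp [simplexPoint, Fin.succ_ne_zero]
  · rw [dotProduct_simplexNormal_succ]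
    refine Fin.cases ?_ (fun i => ?_) i
    · simp [simplexPoint, (Fin.succ_ne_zero k).symm]
    · simp [simplexPoint, Fin.succ_ne_zero, Pi.single_apply, eq_comm]

theorem simplexPoint_sub_dotProduct (i j k : Fin (n + 1)) :
    (simplexPoint i - simplexPoint j : Fin n → ℤ) ⬝ᵥ simplexNormal k =
      (if i = k then 1 else 0) - (if j = k then 1 else 0) := by
  rw [sub_dotProduct, simplexPoint_dotProduct, simplexPoint_dotProduct]
  ring

theorem mem_carrier_iff {x : Fin n → ℝ} : x ∈ (projectivePolytope n).carrier ↔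
    ∀ i, -1 ≤ x ⬝ᵥ toReal (simplexNormal i) := by
  constructor
  · intro hx i
    refine convexHull_min (t := {x | -1 ≤ x ⬝ᵥ toReal (simplexNormal i)}) ?_ ?_ hx
    · rintro _ ⟨w, hw, rfl⟩
      obtain ⟨j, -, rfl⟩ := Finset.mem_image.1 (Finset.mem_coe.1 hw)
      exact neg_one_le_simplexVertex_dot j i
    · exact convex_halfSpace_ge ⟨fun x y => add_dotProduct x y _,
        fun c x => smul_dotProduct c x _⟩ _
  · intro h
    refine mem_simplex x (fun k => ?_) ?_
    · simpa only [real_dotProduct_simplexNormal_succ] using h k.succ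
    · have := h 0
      rw [real_dotProduct_simplexNormal_zero] at this
      linarith

theorem toReal_mem_carrier_iff {v : Fin n → ℤ} : toReal v ∈ (projectivePolytope n).carrier ↔
    ∀ i, -1 ≤ v ⬝ᵥ simplexNormal i := by
  rw [mem_carrier_iff]
  refine forall_congr' fun i => ?_
  rw [toReal_dotProduct]
  exact_mod_cast Iff.rfl

theorem neg_one_le_dotProduct (v : (projectivePolytope n).Pt) (i : Fin (n + 1)) :
    -1 ≤ v.1 ⬝ᵥ simplexNormal i := toReal_mem_carrier_iff.1 v.2 i

theorem simplexPoint_sub_mem (i j : Fin (n + 1)) :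
    toReal (simplexPoint i - simplexPoint j : Fin n → ℤ) ∈ (projectivePolytope n).carrier := by
  rw [toReal_mem_carrier_iff]
  intro k
  rw [simplexPoint_sub_dotProduct]
  split_ifs <;> norm_num

/-- Adding `e_i - e_j` lowers only the pairing with `u_j`, by one, and that integer is at least `0`
when it is not `-1`. -/
theorem add_mem_carrier {v : Fin n → ℤ} (hv : toReal v ∈ (projectivePolytope n).carrier)
    {i j : Fin (n + 1)} (h : v ⬝ᵥ simplexNormal j ≠ -1) :
    toReal (v + (simplexPoint i - simplexPoint j)) ∈ (projectivePolytope n).carrier := by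
  rw [toReal_mem_carrier_iff] at hv ⊢
  intro k
  have hk := hv k
  rw [add_dotProduct, simplexPoint_sub_dotProduct]
  by_cases hjk : j = k
  · subst hjk
    split_ifs <;> omega
  · rw [if_neg hjk]
    split_ifs <;> omega

theorem simplexVertex_mem_carrier (i : Fin (n + 1)) :
    toReal (simplexVertex i) ∈ (projectivePolytope n).carrier :=
  mem_carrier_iff.2 fun j => neg_one_le_simplexVertex_dot i j

theorem simplexVertex_dotProduct_of_ne {i j : Fin (n + 1)} (h : i ≠ j) :
    toReal (simplexVertex i) ⬝ᵥ toReal (simplexNormal j : Fin n → ℤ) = -1 := by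
  rw [simplexVertex_dot, toReal_dotProduct, simplexPoint_dotProduct, if_neg h]
  refine Fin.cases ?_ (fun j => ?_) j
  · simp [simplexNormal, toReal]
  · simp [simplexNormal, toReal, Fin.succ_ne_zero, Pi.single_apply]

theorem polarDual_subset : polarDual (projectivePolytope n).carrier ⊆
    convexHull ℝ (Set.range fun i : Fin (n + 1) => toReal (simplexNormal i : Fin n → ℤ)) :=
  fun u hu => mem_dualSimplex u fun i => hu _ (simplexVertex_mem_carrier i)

theorem simplexNormal_mem_polarDual (j : Fin (n + 1)) :
    toReal (simplexNormal j) ∈ polarDual (projectivePolytope n).carrier :=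
  fun _ hv => mem_carrier_iff.1 hv j

theorem polarDual_eq : polarDual (projectivePolytope n).carrier =
    convexHull ℝ (Set.range fun i : Fin (n + 1) => toReal (simplexNormal i : Fin n → ℤ)) := by
  refine polarDual_subset.antisymm (convexHull_min ?_ ?_)
  · rintro _ ⟨i, rfl⟩
    exact simplexNormal_mem_polarDual i
  · intro x hx y hy s t hs ht hst v hv
    have h1 := hx v hv
    have h2 := hy v hv
    rw [dotProduct_add, dotProduct_smul, dotProduct_smul, smul_eq_mul, smul_eq_mul]
    nlinarith

theorem eq_simplexNormal_of_forall_ne {x : Fin n → ℝ} {j : Fin (n + 1)}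
    (h : ∀ i, i ≠ j → toReal (simplexVertex i) ⬝ᵥ x = -1) : x = toReal (simplexNormal j) := by
  have hn : (0 : ℝ) < n + 1 := by positivity
  have h0 : (toReal (simplexPoint 0 : Fin n → ℤ)) ⬝ᵥ x = 0 := by simp [simplexPoint, toReal_zero]
  have hs : ∀ k : Fin n, (toReal (simplexPoint k.succ : Fin n → ℤ)) ⬝ᵥ x = x k := fun k => by
    simp [simplexPoint, toReal, dotProduct, Pi.single_apply]
  revert h
  refine Fin.cases (fun h => ?_) (fun j h => ?_) j
  · have h1 : ∀ k : Fin n, (n + 1) * x k - ∑ k, x k = -1 := fun k => by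
      rw [← h k.succ (Fin.succ_ne_zero k), simplexVertex_dot, hs]
    have h2 : ∑ k, ((n + 1) * x k - ∑ k, x k) = ∑ _k : Fin n, (-1 : ℝ) :=
      Finset.sum_congr rfl fun k _ => h1 k
    rw [Finset.sum_sub_distrib, ← Finset.mul_sum] at h2
    simp only [Finset.sum_const, Finset.card_univ, Fintype.card_fin, nsmul_eq_mul] at h2
    have h3 : ∑ k, x k = -n := by linarith
    funext k
    have h4 := h1 k
    rw [h3] at h4
    have h5 : (n + 1) * x k = (n + 1) * (-1 : ℝ) := by linarith
    simpa [simplexNormal, toReal] using mul_left_cancel₀ hn.ne' h5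
  · have h1 : ∑ k, x k = 1 := by
      have := h 0 (Fin.succ_ne_zero j).symm
      rw [simplexVertex_dot, h0] at this
      linarith
    have h2 : ∀ k, k ≠ j → x k = 0 := fun k hk => by
      have := h k.succ fun h => hk (Fin.succ_injective _ h)
      rw [simplexVertex_dot, hs, h1] at this
      have h5 : (n + 1) * x k = 0 := by linarith
      exact (mul_eq_zero.1 h5).resolve_left hn.ne'
    funext k
    by_cases hk : k = j
    · subst hk
      rw [Finset.sum_eq_single k (fun i _ hi => h2 i hi) (by simp)] at h1
      simp [simplexNormal, toReal, h1]
    · simp [simplexNormal, toReal, h2 k hk, hk]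

theorem mem_extremePoints_polarDual_iff {u : Fin n → ℝ} :
    u ∈ (polarDual (projectivePolytope n).carrier).extremePoints ℝ ↔
      ∃ j, u = toReal (simplexNormal j) := by
  constructor
  · intro hu
    rw [polarDual_eq] at hu
    obtain ⟨i, hi⟩ := extremePoints_convexHull_subset hu
    exact ⟨i, hi.symm⟩
  · rintro ⟨j, rfl⟩
    refine ⟨simplexNormal_mem_polarDual j, ?_⟩
    rintro x hx y hy ⟨s, t, hs, ht, hst, hxy⟩
    -- The inequalities at the vertices `i ≠ j` are tight at `u_j`, hence tight at both ends of a
    -- segment through it, and they determine the point.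
    refine eq_simplexNormal_of_forall_ne fun i hi => ?_
    have h1 := hx _ (simplexVertex_mem_carrier i)
    have h2 := hy _ (simplexVertex_mem_carrier i)
    have h3 := simplexVertex_dotProduct_of_ne hi
    rw [← hxy, dotProduct_add, dotProduct_smul, dotProduct_smul, smul_eq_mul, smul_eq_mul] at h3
    refine le_antisymm ?_ h1
    nlinarith

theorem mem_intrinsicInterior_facet_iff {j : Fin (n + 1)} {x : Fin n → ℝ} :
    x ∈ intrinsicInterior ℝ
      {x | x ∈ (projectivePolytope n).carrier ∧ x ⬝ᵥ toReal (simplexNormal j) = -1} ↔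
    x ⬝ᵥ toReal (simplexNormal j) = -1 ∧
      ∀ k, k ≠ j → -1 < x ⬝ᵥ toReal (simplexNormal k) := by
  set F := {x | x ∈ (projectivePolytope n).carrier ∧ x ⬝ᵥ toReal (simplexNormal j) = -1} with hF
  rw [mem_intrinsicInterior]
  constructor
  · rintro ⟨y, hy, rfl⟩
    have hyF : (y : Fin n → ℝ) ∈ F := interior_subset (s := ((↑) ⁻¹' F : Set (affineSpan ℝ F))) hy
    refine ⟨hyF.2, fun k hk => lt_of_le_of_ne (mem_carrier_iff.1 hyF.1 k) fun hyk => ?_⟩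
    set z : Fin n → ℝ := toReal (simplexPoint k - simplexPoint j) with hz
    have hzF : z ∈ F := by
      refine ⟨simplexPoint_sub_mem k j, ?_⟩
      rw [hz, toReal_dotProduct, simplexPoint_sub_dotProduct, if_neg hk, if_pos rfl]
      norm_num
    have hzk : z ⬝ᵥ toReal (simplexNormal k) = 1 := by
      rw [hz, toReal_dotProduct, simplexPoint_sub_dotProduct, if_neg hk.symm, if_pos rfl]
      norm_num
    -- If a further inequality `k` were tight at `y`, prolonging the segment from `z = e_k - e_j`
    -- slightly beyond `y` would violate it without leaving the affine span of the facet.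
    let line : ℝ → affineSpan ℝ F := fun t =>
      ⟨AffineMap.lineMap z (y : Fin n → ℝ) (1 + t),
        AffineMap.lineMap_mem _ (subset_affineSpan ℝ F hzF) y.2⟩
    have hline : Continuous line := by
      refine Continuous.subtype_mk ?_ _
      exact AffineMap.lineMap_continuous.comp (by fun_prop)
    have h0 : line 0 ∈ interior ((↑) ⁻¹' F : Set (affineSpan ℝ F)) := by
      have : line 0 = y := Subtype.ext (by simp [line])
      rwa [this]
    have hnhds := hline.continuousAt.preimage_mem_nhds (isOpen_interior.mem_nhds h0)
    obtain ⟨δ, hδ, hball⟩ := Metric.mem_nhds_iff.1 hnhds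
    have hmem : δ / 2 ∈ Metric.ball (0 : ℝ) δ := by
      rw [Metric.mem_ball, dist_zero_right, Real.norm_of_nonneg (by linarith)]
      linarith
    have h1 : (line (δ / 2) : Fin n → ℝ) ∈ F :=
      interior_subset (s := ((↑) ⁻¹' F : Set (affineSpan ℝ F))) (hball hmem)
    have h2 := mem_carrier_iff.1 h1.1 k
    simp only [line, AffineMap.lineMap_apply, vsub_eq_sub, vadd_eq_add, add_dotProduct,
      smul_dotProduct, sub_dotProduct, smul_eq_mul, hzk, ← hyk] at h2
    linarith
  · rintro ⟨hj, hk⟩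
    have hxF : x ∈ F := ⟨mem_carrier_iff.2 fun k => by
      by_cases h : k = j
      · rw [h, hj]
      · exact (hk k h).le, hj⟩
    refine ⟨⟨x, subset_affineSpan ℝ F hxF⟩, ?_, rfl⟩
    rw [mem_interior]
    -- On the affine span the equation for `j` holds automatically, so the remaining strict
    -- inequalities cut out an open subset of the facet.
    refine ⟨{y | ∀ k, k ≠ j → -1 < (y : Fin n → ℝ) ⬝ᵥ toReal (simplexNormal k)}, ?_, ?_, hk⟩
    · rintro ⟨y, hyF⟩ hy
      have hyj : y ⬝ᵥ toReal (simplexNormal j) = -1 := by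
        refine affineSpan_induction (p := fun y => y ⬝ᵥ toReal (simplexNormal j) = -1) hyF
          (fun z hz => hz.2) fun c u v w hu hv hw => ?_
        rw [vsub_eq_sub, vadd_eq_add, add_dotProduct, smul_dotProduct, sub_dotProduct, hu, hv, hw]
        simp
      refine ⟨mem_carrier_iff.2 fun k => ?_, hyj⟩
      by_cases h : k = j
      · rw [h, hyj]
      · exact (hy k h).le
    · simp only [Set.ofPred_forall]
      refine isOpen_iInter_of_finite fun k => isOpen_iInter_of_finite fun _ => ?_
      refine isOpen_lt continuous_const ?_
      exact continuous_finsetSum _ fun i _ =>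
        ((continuous_apply i).comp continuous_subtype_val).mul continuous_const

/-- The pairings `⟨v, u_k⟩` are integers with sum zero, one of them `-1` and the others nonnegative.
Hence exactly one is `1` and the rest vanish. -/
theorem isRoot_iff (u v : Fin n → ℤ) : IsRoot (projectivePolytope n) u v ↔
    ∃ i j : Fin (n + 1), i ≠ j ∧ u = simplexNormal j ∧ v = simplexPoint i - simplexPoint j := by
  unfold IsRoot
  rw [mem_extremePoints_polarDual_iff]
  constructor
  · rintro ⟨⟨j, hj⟩, hv⟩
    obtain rfl := toReal_injective hj
    rw [mem_intrinsicInterior_facet_iff] at hv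
    simp only [toReal_dotProduct] at hv
    obtain ⟨hvj, hvk⟩ := hv
    have hvj : v ⬝ᵥ simplexNormal j = -1 := by exact_mod_cast hvj
    have hvk : ∀ k, k ≠ j → 0 ≤ v ⬝ᵥ simplexNormal k := fun k hk => by
      have h : (-1 : ℤ) < v ⬝ᵥ simplexNormal k := by exact_mod_cast hvk k hk
      omega
    have hsum := sum_dotProduct_simplexNormal v
    rw [← Finset.add_sum_erase _ _ (Finset.mem_univ j), hvj] at hsum
    obtain ⟨i, hi, hpos⟩ : ∃ i ∈ Finset.univ.erase j, 0 < v ⬝ᵥ simplexNormal i := by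
      by_contra! h
      have := Finset.sum_nonpos h
      omega
    have hij := Finset.ne_of_mem_erase hi
    rw [← Finset.add_sum_erase _ _ hi] at hsum
    have hnn : ∀ k ∈ (Finset.univ.erase j).erase i, 0 ≤ v ⬝ᵥ simplexNormal k := fun k hk =>
      hvk k (Finset.ne_of_mem_erase (Finset.mem_of_mem_erase hk))
    have hs0 := Finset.sum_nonneg hnn
    have hzero := (Finset.sum_eq_zero_iff_of_nonneg hnn).1 (by omega)
    refine ⟨i, j, hij, rfl, ext_simplexNormal fun k => ?_⟩
    rw [simplexPoint_sub_dotProduct]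
    by_cases hki : i = k
    · subst hki
      rw [if_pos rfl, if_neg hij.symm]
      omega
    · by_cases hkj : j = k
      · subst hkj
        rw [if_neg hki, if_pos rfl, hvj]
        rfl
      · rw [if_neg hki, if_neg hkj, hzero k (by simp [Ne.symm hki, Ne.symm hkj])]
        rfl
  · rintro ⟨i, j, hij, rfl, rfl⟩
    refine ⟨⟨j, rfl⟩, mem_intrinsicInterior_facet_iff.2 ⟨?_, fun k hk => ?_⟩⟩
    · rw [toReal_dotProduct, simplexPoint_sub_dotProduct, if_neg hij, if_pos rfl]
      norm_num
    · rw [toReal_dotProduct, simplexPoint_sub_dotProduct, if_neg hk.symm]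
      split_ifs <;> norm_num

end ProjectiveSpace

/-! ### Maximal simplices reach the boundary of the polytope -/

section Boundary

variable {n : ℕ}

/-- The values of a linear functional on a convex hull. -/
theorem dotProduct_le_of_mem_convexHull {s : Set (Fin n → ℝ)} {w : Fin n → ℝ} {c : ℝ}
    (h : ∀ x ∈ s, x ⬝ᵥ w ≤ c) {x : Fin n → ℝ} (hx : x ∈ convexHull ℝ s) : x ⬝ᵥ w ≤ c :=
  convexHull_min (t := {x | x ⬝ᵥ w ≤ c}) h (convex_halfSpace_le ⟨fun x y => add_dotProduct x y _,
    fun c x => smul_dotProduct c x _⟩ _) hx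

/-- The vertices other than the origin of a maximal simplex lie in a facet of the polytope. -/
theorem exists_facet_normal {T : Geometry.SimplicialComplex ℝ (Fin n → ℝ)}
    (hT : IsRegularProjective (projectivePolytope n) T) (hn : n ≠ 0) {s : Finset (Fin n → ℝ)}
    (hs : s ∈ T.facets) : ∃ j : Fin (n + 1), ∀ v : (projectivePolytope n).Pt,
      toReal v.1 ∈ s → v ≠ (projectivePolytope n).origin → v.1 ⬝ᵥ simplexNormal j = -1 := by
  classical
  obtain ⟨b, p, hp, hmem⟩ := exists_basis_of_facet hT hs
  have hn0 : (0 : ℝ) < n := by exact_mod_cast Nat.pos_of_ne_zero hn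
  have hzero : ∀ t ∈ T.facets, (0 : Fin n → ℝ) ∈ t := fun t ht => by
    obtain ⟨b', hb'⟩ := hT.regular t ht
    rw [← Finset.mem_coe, hb']
    exact Set.mem_insert _ _
  have hbs : ∀ k, toReal (b k) ∈ s := fun k => by
    rw [← hp]; exact (hmem _).2 (Or.inr ⟨k, rfl⟩)
  have hs_cases : ∀ x ∈ s, x = 0 ∨ ∃ k, x = toReal (b k) := fun x hx => by
    obtain ⟨v, rfl⟩ : ∃ v : (projectivePolytope n).Pt, toReal v.1 = x := by
      obtain ⟨b', hb'⟩ := hT.regular s hs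
      have hx' : x ∈ (s : Set (Fin n → ℝ)) := hx
      have hxc := mem_carrier_of_mem_facet hT hs hx
      rw [hb'] at hx'
      rcases hx' with rfl | ⟨k, rfl⟩
      · exact ⟨(projectivePolytope n).origin, toReal_zero⟩
      · exact ⟨⟨b' k, hxc⟩, rfl⟩
    rcases (hmem v).1 hx with rfl | ⟨k, rfl⟩
    · exact Or.inl toReal_zero
    · exact Or.inr ⟨k, by rw [hp]⟩
  set w : Fin n → Fin n → ℝ := fun k => toReal fun j => b.coord k (Pi.single j 1) with hw
  have hbw : ∀ i k, toReal (b i) ⬝ᵥ w k = if i = k then 1 else 0 := fun i k => by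
    rw [hw, toReal_dotProduct, ← linearMap_eq_dotProduct, Module.Basis.coord_apply, b.repr_self,
      Finsupp.single_apply]
    push_cast
    rfl
  -- The barycentre of the nonzero vertices: it suffices that `c` lies on a facet of the polytope.
  set c : Fin n → ℝ := ∑ k, (n : ℝ)⁻¹ • toReal (b k) with hc
  have hcw : ∀ k, c ⬝ᵥ w k = (n : ℝ)⁻¹ := fun k => by
    rw [hc, sum_dotProduct]
    simp [smul_dotProduct, hbw]
  have hcs : c ∈ convexHull ℝ (s : Set (Fin n → ℝ)) := by
    refine (convex_convexHull ℝ _).sum_mem (fun _ _ => by positivity) ?_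
      fun k _ => subset_convexHull ℝ _ (hbs k)
    simp only [Finset.sum_const, Finset.card_univ, Fintype.card_fin, nsmul_eq_mul]
    exact mul_inv_cancel₀ hn0.ne'
  have hcP : c ∈ (projectivePolytope n).carrier := by
    rw [← hT.space_eq]
    exact Geometry.SimplicialComplex.convexHull_subset_space (T.facets_subset hs) hcs
  have key : ∃ j : Fin (n + 1), c ⬝ᵥ toReal (simplexNormal j) = -1 := by
    -- Otherwise `c` can be pushed outwards to `μ c` with `μ > 1`, lying in some maximal simplex
    -- `t`. As `0 ∈ t`, also `c ∈ t`. All dual coordinates of `c` are positive, which forces `s ⊆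
    -- t`, hence `s = t`. But the coordinates of a point of `s` sum to at most `1`, those of `μ c`
    -- to `μ`.
    by_contra! hne
    have hlt : ∀ j, -1 < c ⬝ᵥ toReal (simplexNormal j) := fun j =>
      lt_of_le_of_ne (mem_carrier_iff.1 hcP j) (hne j).symm
    obtain ⟨μ, hμ1, hμ⟩ : ∃ μ : ℝ, 1 < μ ∧ ∀ j : Fin (n + 1),
        -1 < μ * (c ⬝ᵥ toReal (simplexNormal j)) := by
      have h1 : ∀ᶠ μ in nhdsWithin (1 : ℝ) (Set.Ioi 1), ∀ j : Fin (n + 1),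
          -1 < μ * (c ⬝ᵥ toReal (simplexNormal j)) := by
        refine Filter.eventually_all.2 fun j => nhdsWithin_le_nhds ?_
        have : ContinuousAt (fun μ : ℝ => μ * (c ⬝ᵥ toReal (simplexNormal j))) 1 := by fun_prop
        exact this.eventually (lt_mem_nhds (by simpa using hlt j))
      obtain ⟨μ, hμ⟩ := (h1.and self_mem_nhdsWithin).exists
      exact ⟨μ, hμ.2, hμ.1⟩
    have hμP : μ • c ∈ T.space := by
      rw [hT.space_eq, mem_carrier_iff]
      intro j
      rw [smul_dotProduct, smul_eq_mul]
      exact (hμ j).le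
    obtain ⟨t₀, ht₀, hμt₀⟩ := Geometry.SimplicialComplex.mem_space_iff.1 hμP
    obtain ⟨t, ht, ht₀t⟩ := exists_facet_superset ht₀
    have hμt : μ • c ∈ convexHull ℝ (t : Set (Fin n → ℝ)) :=
      convexHull_mono (Finset.coe_subset.2 ht₀t) hμt₀
    have hct : c ∈ convexHull ℝ (t : Set (Fin n → ℝ)) := by
      have h1 := (convex_convexHull ℝ (t : Set (Fin n → ℝ))) hμt
        (subset_convexHull ℝ _ (hzero t ht)) (a := μ⁻¹) (b := 1 - μ⁻¹) (by positivity)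
        (sub_nonneg.2 (inv_le_one_of_one_le₀ hμ1.le)) (by ring)
      rwa [smul_smul, inv_mul_cancel₀ (by positivity), one_smul, smul_zero, add_zero] at h1
    have hcst := T.inter_subset_convexHull (T.facets_subset hs) (T.facets_subset ht) ⟨hcs, hct⟩
    have hst : s ⊆ t := by
      intro x hx
      rcases hs_cases x hx with rfl | ⟨k, rfl⟩
      · exact hzero t ht
      · by_contra hkt
        have h1 : c ⬝ᵥ w k ≤ 0 := by
          refine dotProduct_le_of_mem_convexHull (fun y hy => ?_) hcst
          rcases hs_cases y hy.1 with rfl | ⟨i, rfl⟩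
          · simp
          · have hik : i ≠ k := fun h => hkt (h ▸ hy.2)
            rw [hbw, if_neg hik]
        rw [hcw] at h1
        exact absurd h1 (not_le.2 (by positivity))
    have hst' : s = t := hs.2 (T.facets_subset ht) hst
    subst hst'
    have h2 : (μ • c) ⬝ᵥ (∑ k, w k) ≤ 1 := by
      refine dotProduct_le_of_mem_convexHull (fun y hy => ?_) hμt
      rcases hs_cases y hy with rfl | ⟨i, rfl⟩
      · simp
      · rw [dotProduct_sum]
        simp [hbw]
    rw [smul_dotProduct, dotProduct_sum] at h2
    simp only [hcw, Finset.sum_const, Finset.card_univ, Fintype.card_fin, nsmul_eq_mul,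
      smul_eq_mul, mul_inv_cancel₀ hn0.ne'] at h2
    linarith
  obtain ⟨j, hj⟩ := key
  refine ⟨j, fun v hv hv0 => ?_⟩
  have hsum : ∑ k, ((p k).1 ⬝ᵥ simplexNormal j + 1) = 0 := by
    have h1 : ∑ k, (n : ℝ)⁻¹ * (((p k).1 ⬝ᵥ simplexNormal j : ℤ) : ℝ) = -1 := by
      rw [← hj, hc, sum_dotProduct]
      refine Finset.sum_congr rfl fun k _ => ?_
      rw [smul_dotProduct, toReal_dotProduct, hp, smul_eq_mul]
    rw [← Finset.mul_sum, inv_mul_eq_iff_eq_mul₀ hn0.ne'] at h1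
    have h2 : (∑ k, (p k).1 ⬝ᵥ simplexNormal j : ℤ) = -n := by
      have : ((∑ k, (p k).1 ⬝ᵥ simplexNormal j : ℤ) : ℝ) = ((-n : ℤ) : ℝ) := by
        push_cast
        linarith
      exact_mod_cast this
    rw [Finset.sum_add_distrib, h2]
    simp
  -- Values that are at least `-1` and average to `-1` are all equal to `-1`.
  have h3 := (Finset.sum_eq_zero_iff_of_nonneg fun k _ => by
    have := neg_one_le_dotProduct (p k) j
    omega).1 hsum
  obtain ⟨k, rfl⟩ := ((hmem v).1 hv).resolve_left hv0
  have := h3 k (Finset.mem_univ k)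
  omega

/-- The affine function `1 + ⟨v,u⟩` of the facet through `s` is `1` at the origin, `0` at the other
vertices of `s` and nonnegative elsewhere. Pairing `ℓ` with it gives zero, and all terms away from
the origin are nonnegative. For `n = 0` the origin is the only lattice point and `u = 0` works. -/
theorem apply_origin_nonpos {T : Geometry.SimplicialComplex ℝ (Fin n → ℝ)}
    (hT : IsRegularProjective (projectivePolytope n) T) {ℓ : (projectivePolytope n).Pt → ℤ}
    (hℓ : ℓ ∈ relationLattice (projectivePolytope n))
    (h : ∃ s ∈ T.facets, ∀ v : (projectivePolytope n).Pt, toReal v.1 ∉ s → 0 ≤ ℓ v) :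
    ℓ (projectivePolytope n).origin ≤ 0 := by
  obtain ⟨s, hs, hpos⟩ := h
  have hu : ∃ u : Fin n → ℤ, (∀ v : (projectivePolytope n).Pt, -1 ≤ v.1 ⬝ᵥ u) ∧
      ∀ v : (projectivePolytope n).Pt, toReal v.1 ∈ s → v ≠ (projectivePolytope n).origin →
        v.1 ⬝ᵥ u = -1 := by
    by_cases hn : n = 0
    · subst hn
      exact ⟨0, fun v => by simp, fun v _ hv => absurd (Subtype.ext (Subsingleton.elim _ _)) hv⟩
    · obtain ⟨j, hj⟩ := exists_facet_normal hT hn hs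
      exact ⟨simplexNormal j, fun v => neg_one_le_dotProduct v j, hj⟩
  obtain ⟨u, hu1, hu2⟩ := hu
  have h1 := relationLattice_sum_eq_zero hℓ 1 (toReal u)
  have h2 : ∑ v, ℓ v * (1 + v.1 ⬝ᵥ u) = 0 := by
    simp only [toReal_dotProduct, dotProduct_comm u] at h1
    exact_mod_cast h1
  rw [← Finset.add_sum_erase _ _ (Finset.mem_univ (projectivePolytope n).origin)] at h2
  have h3 : 0 ≤ ∑ v ∈ Finset.univ.erase (projectivePolytope n).origin, ℓ v * (1 + v.1 ⬝ᵥ u) := by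
    refine Finset.sum_nonneg fun v hv => ?_
    by_cases hvs : toReal v.1 ∈ s
    · rw [hu2 v hvs (Finset.ne_of_mem_erase hv)]
      simp
    · exact mul_nonneg (hpos v hvs) (by have := hu1 v; omega)
  have h4 : (projectivePolytope n).origin.1 ⬝ᵥ u = 0 := by
    simp [ReflexivePolytope.origin]
  rw [h4] at h2
  linarith

end Boundary

/-! ### Root operators as elementary matrices -/

section SpecialLinear

variable {n : ℕ}

/-- The monomial `∏_k z_k^{⟨v, u_k⟩ + 1}`. -/
def sectionMonomial (v : Fin n → ℤ) : MvPolynomial (Fin (n + 1)) ℂ :=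
  ∏ i, MvPolynomial.X i ^ (v ⬝ᵥ simplexNormal i + 1).toNat

theorem anticanonicalSection_eq (a : (projectivePolytope n).Pt → ℂ) :
    anticanonicalSection a = ∑ v, a v • sectionMonomial v.1 := by
  simp only [anticanonicalSection, sectionMonomial, MvPolynomial.smul_eq_C_mul]

theorem slAction_single {i j : Fin (n + 1)} (hij : i ≠ j) (q : MvPolynomial (Fin (n + 1)) ℂ) :
    slAction (LieAlgebra.SpecialLinear.single i j hij 1) q =
      MvPolynomial.X i * MvPolynomial.pderiv j q := by
  unfold slAction
  rw [Finset.sum_eq_single i, Finset.sum_eq_single j]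
  · simp
  · intro k _ hk
    simp [hk.symm]
  · simp
  · intro k _ hk
    refine Finset.sum_eq_zero fun m _ => ?_
    simp [hk.symm]
  · simp

/-- On the polytope all exponents are nonnegative, so `toNat` is harmless. If the exponent of `z_j`
is zero the shifted monomial is meaningless, but both sides vanish. -/
theorem X_mul_pderiv_sectionMonomial {i j : Fin (n + 1)} (hij : i ≠ j)
    (v : (projectivePolytope n).Pt) :
    MvPolynomial.X i * MvPolynomial.pderiv j (sectionMonomial v.1) =
      ((v.1 ⬝ᵥ simplexNormal j + 1 : ℤ) : ℂ) •
        sectionMonomial (v.1 + (simplexPoint i - simplexPoint j)) := by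
  have hmon : ∀ w : Fin n → ℤ, sectionMonomial w = MvPolynomial.monomial
      (Finsupp.equivFunOnFinite.symm fun k => (w ⬝ᵥ simplexNormal k + 1).toNat) 1 := fun w => by
    rw [MvPolynomial.monomial_eq, MvPolynomial.C_1, one_mul, Finsupp.prod_fintype _ _ (by simp)]
    rfl
  have hX : (MvPolynomial.X i : MvPolynomial (Fin (n + 1)) ℂ) =
      MvPolynomial.monomial (Finsupp.single i 1) 1 := rfl
  have hj := neg_one_le_dotProduct v j
  rw [hmon, hmon, MvPolynomial.pderiv_monomial, hX, MvPolynomial.monomial_mul,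
    MvPolynomial.smul_monomial]
  have hc : (((v.1 ⬝ᵥ simplexNormal j + 1).toNat : ℕ) : ℂ) =
      ((v.1 ⬝ᵥ simplexNormal j + 1 : ℤ) : ℂ) := by
    rw [← Int.cast_natCast, Int.toNat_of_nonneg (by omega)]
  by_cases h : v.1 ⬝ᵥ simplexNormal j = -1
  · simp [h]
  · refine congrArg₂ (fun s (c : ℂ) => MvPolynomial.monomial s c) ?_ ?_
    · ext k
      have hk := neg_one_le_dotProduct v k
      simp only [Finsupp.add_apply, Finsupp.tsub_apply, Finsupp.single_apply,
        Finsupp.equivFunOnFinite_symm_apply_apply, add_dotProduct, simplexPoint_sub_dotProduct]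
      by_cases hjk : j = k
      · subst hjk
        simp only [if_neg hij, if_true]
        omega
      · simp only [if_neg hjk]
        split_ifs <;> omega
    · simp only [Finsupp.equivFunOnFinite_symm_apply_apply, one_mul, smul_eq_mul, mul_one]
      exact hc

theorem exists_rootOperator_eq_fderiv {i j : Fin (n + 1)} (hij : i ≠ j)
    (a : (projectivePolytope n).Pt → ℂ) : ∃ b : (projectivePolytope n).Pt → ℂ,
      anticanonicalSection b =
        slAction (LieAlgebra.SpecialLinear.single i j hij 1) (anticanonicalSection a) ∧
      ∀ f : ((projectivePolytope n).Pt → ℂ) → ℂ,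
        rootOperator (projectivePolytope n) (simplexNormal j)
            (simplexPoint i - simplexPoint j) f a =
          fderiv ℂ f a b := by
  -- The value of the vector field at `a`. Since `fderiv ℂ f a` is linear for any `f`, no
  -- differentiability is needed.
  refine ⟨∑ v' : (projectivePolytope n).Pt, ∑ w : (projectivePolytope n).Pt with
    v'.1 ⬝ᵥ simplexNormal j ≠ -1 ∧ w.1 = v'.1 + (simplexPoint i - simplexPoint j),
    (((v'.1 ⬝ᵥ simplexNormal j + 1 : ℤ) : ℂ) * a v') • Pi.single w 1, ?_, fun f => ?_⟩
  · have hlin : ∀ c : (projectivePolytope n).Pt → ℂ, anticanonicalSection c =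
        Fintype.linearCombination ℂ (fun v : (projectivePolytope n).Pt => sectionMonomial v.1) c :=
      anticanonicalSection_eq
    rw [slAction_single, hlin, anticanonicalSection_eq, map_sum, map_sum, Finset.mul_sum]
    refine Finset.sum_congr rfl fun v _ => ?_
    rw [Derivation.map_smul, mul_smul_comm, X_mul_pderiv_sectionMonomial hij, map_sum]
    simp only [map_smul, Fintype.linearCombination_apply_single, one_smul]
    by_cases h : v.1 ⬝ᵥ simplexNormal j = -1
    · simp [h]
    · have h3 : (Finset.univ.filter fun w : (projectivePolytope n).Pt =>
          v.1 ⬝ᵥ simplexNormal j ≠ -1 ∧ w.1 = v.1 + (simplexPoint i - simplexPoint j)) =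
          {⟨_, add_mem_carrier (i := i) v.2 h⟩} := by
        ext x
        simp only [Finset.mem_filter, Finset.mem_univ, true_and, Finset.mem_singleton]
        exact ⟨fun hx => Subtype.ext hx.2, fun hx => ⟨h, hx ▸ rfl⟩⟩
      rw [h3, Finset.sum_singleton, smul_smul, mul_comm]
  · simp only [rootOperator, map_sum, map_smul, smul_eq_mul, partialDeriv]

end SpecialLinear

end GKZ

end

theorem mainTheorem3 (n : ℕ) :
    (∀ T : Geometry.SimplicialComplex ℝ (Fin n → ℝ),
      GKZ.IsRegularProjective (GKZ.projectivePolytope n) T →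
      ∀ (r : ℕ)
        (l : Module.Basis (Fin r) ℤ (GKZ.relationLattice (GKZ.projectivePolytope n))),
        (∀ ℓ : GKZ.relationLattice (GKZ.projectivePolytope n),
          ℓ.1 ∈ GKZ.moriPoints (GKZ.projectivePolytope n) T → ∀ j, 0 ≤ l.repr ℓ j) →
        ∃ ε : ℝ, 0 < ε ∧
          (∀ a ∈ GKZ.lcslNhd (GKZ.projectivePolytope n) l ε,
            Summable fun ℓ : GKZ.moriPoints (GKZ.projectivePolytope n) T =>
              GKZ.laurent ℓ.1 a • GKZ.oCoeff (GKZ.projectivePolytope n) T ℓ.1) ∧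
          ∀ U : Set ((GKZ.projectivePolytope n).Pt → ℂ),
            IsOpen U → U ⊆ GKZ.lcslNhd (GKZ.projectivePolytope n) l ε →
            ∀ lg : ((GKZ.projectivePolytope n).Pt → ℂ) → (GKZ.projectivePolytope n).Pt → ℂ,
              GKZ.IsLogBranch U lg →
              ∀ α : GKZ.Cohomology (GKZ.projectivePolytope n) T →ₗ[ℂ] ℂ,
                GKZ.IsExtendedGKZSolution (GKZ.projectivePolytope n) U fun a =>
                  α (GKZ.bFunction (GKZ.projectivePolytope n) T lg a *
                    -GKZ.divisorClass (GKZ.projectivePolytope n) T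
                      (GKZ.projectivePolytope n).origin)) ∧
    (∀ u v : Fin n → ℤ, GKZ.IsRoot (GKZ.projectivePolytope n) u v ↔
      ∃ i j : Fin (n + 1), i ≠ j ∧ u = GKZ.simplexNormal j ∧
        v = GKZ.simplexPoint i - GKZ.simplexPoint j) ∧
    (∀ (i j : Fin (n + 1)) (hij : i ≠ j) (a : (GKZ.projectivePolytope n).Pt → ℂ),
      ∃ b : (GKZ.projectivePolytope n).Pt → ℂ,
        GKZ.anticanonicalSection b =
          GKZ.slAction (LieAlgebra.SpecialLinear.single i j hij 1)
            (GKZ.anticanonicalSection a) ∧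
        ∀ f : ((GKZ.projectivePolytope n).Pt → ℂ) → ℂ,
          GKZ.rootOperator (GKZ.projectivePolytope n) (GKZ.simplexNormal j)
            (GKZ.simplexPoint i - GKZ.simplexPoint j) f a = fderiv ℂ f a b) := by
  refine ⟨fun T hT r l hl => ?_, GKZ.isRoot_iff, fun i j hij a =>
    GKZ.exists_rootOperator_eq_fderiv hij a⟩
  -- For this part, projective space enters only through the sign of `ℓ_0`, the list of roots and
  -- the closure of the lattice points under adding a root.
  obtain ⟨ε, hε, hsum, h⟩ := GKZ.exists_radius hT
    (fun ℓ hℓ hs => GKZ.apply_origin_nonpos hT hℓ hs) l hl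
  refine ⟨ε, hε, hsum, fun U hU hUl lg hlg α => ?_⟩
  obtain ⟨h1, h2⟩ := h U hU hUl lg hlg α _ rfl
  refine ⟨h1, fun u v huv a ha => ?_⟩
  obtain ⟨i, j, hij, rfl, rfl⟩ := (GKZ.isRoot_iff u v).1 huv
  refine h2 _ ⟨_, GKZ.simplexPoint_sub_mem i j⟩ ?_ (fun v' hv' => ?_) a ha
  · rw [GKZ.simplexPoint_sub_dotProduct, if_neg hij, if_pos rfl]
    rfl
  · exact ⟨⟨_, GKZ.add_mem_carrier v'.2 hv'⟩, rfl⟩
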